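/- Let $d\ge 0$ and let $h(t)\in\mathbb{R}[t]$ be a polynomial with nonnegative coefficients, of degree $s\le d$, such that $h(t)=t^{s}h(1/t)$. For integers $r\ge 1$ let $U_r^{d+1}h(t)$ be the unique polynomial such that $\sum_{n\ge 0}a_{rn}t^n=\frac{U_r^{d+1}h(t)}{(1-t)^{d+1}}$, where the sequence $(a_n)$ is defined by $\sum_{n\ge 0}a_{n}t^n=\frac{h(t)}{(1-t)^{d+1}}$. Then for every integer $r\ge\max\{s,d+1-s\}$ the polynomial $U_r^{d+1}h(t)$ has a nonnegative interlacing symmetric decomposition with respect to degree $d$. That is, there are polynomials $\tilde p,\tilde q\in\mathbb{R}[t]$ with \[ U_r^{d+1}h(t)=\tilde p(t)+t\,\tilde q(t),\qquad \tilde p(t)=t^{d}\,\tilde p(1/t),\qquad \tilde q(t)=t^{d-1}\,\tilde q(1/t), \] such that $\tilde p$ and $\tilde q$ have only nonnegative coefficients and $\tilde q\preceq\tilde p$. Here $f\preceq g$ means that $f$ and $g$ are both real-rooted and that either one of them is the zero polynomial (which counts as real-rooted) or, with $\dots\le s_2\le s_1$ the roots of $f$ and $\dots\le t_2\le t_1$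 the roots of $g$, listed with multiplicity, $\deg g\in\{\deg f,\deg f+1\}$ and $\dots\le s_2\le t_2\le s_1\le t_1$. -/

import Mathlib

open Polynomial

/-- `f` is the polynomial such that `∑ a_{rn} tⁿ = f(t) / (1 - t)^D` whenever
`∑ a_n tⁿ = h(t) / (1 - t)^D` (identities of formal power series, with the denominators
cleared). -/
def IsVeroneseNumerator (r D : ℕ) (h f : ℝ[X]) : Prop :=
  ∀ a : ℕ → ℝ,
    PowerSeries.mk a * (1 - PowerSeries.X) ^ D = (h : PowerSeries ℝ) →
      PowerSeries.mk (fun n => a (r * n)) * (1 - PowerSeries.X) ^ D = (f : PowerSeries ℝ)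

theorem section_mul_one_sub_pow {r : ℕ} (hr : 1 ≤ r) (D : ℕ) (A : PowerSeries ℝ) :
    PowerSeries.mk (fun n => PowerSeries.coeff (r * n)
        (A * (1 - (PowerSeries.X : PowerSeries ℝ) ^ r) ^ D)) =
      PowerSeries.mk (fun n => PowerSeries.coeff (r * n) A) * (1 - PowerSeries.X) ^ D := by
  induction D generalizing A with
  | zero => simp
  | succ D ih =>
    rw [pow_succ', ← mul_assoc, ih, pow_succ', ← mul_assoc]
    congr 1
    ext n
    rw [PowerSeries.coeff_mk, mul_sub, mul_sub, mul_one, mul_one, map_sub, map_sub,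
      PowerSeries.coeff_mk, PowerSeries.coeff_mul_X_pow']
    cases n with
    | zero =>
      have h0 : r ≠ 0 := by omega
      simp [h0]
    | succ n =>
      have h1 : r ≤ r * (n + 1) := Nat.le_mul_of_pos_right _ (by omega)
      have h2 : r * (n + 1) - r = r * n := by rw [Nat.mul_succ]; omega
      rw [if_pos h1, h2, PowerSeries.coeff_succ_mul_X, PowerSeries.coeff_mk]

theorem existsUnique_isVeroneseNumerator {r : ℕ} (hr : 1 ≤ r) (D : ℕ) (h : ℝ[X]) :
    ∃! f : ℝ[X], IsVeroneseNumerator r D h f := by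
  have huniq : ∀ f g : ℝ[X], IsVeroneseNumerator r D h f → IsVeroneseNumerator r D h g →
      f = g := by
    intro f g hf hg
    have ha : PowerSeries.mk (fun n => PowerSeries.coeff n
        ((h : PowerSeries ℝ) * (PowerSeries.invOneSubPow ℝ D : PowerSeries ℝ))) *
          (1 - PowerSeries.X) ^ D = (h : PowerSeries ℝ) := by
      have : PowerSeries.mk (fun n => PowerSeries.coeff n
        ((h : PowerSeries ℝ) * (PowerSeries.invOneSubPow ℝ D : PowerSeries ℝ))) =
          (h : PowerSeries ℝ) * (PowerSeries.invOneSubPow ℝ D : PowerSeries ℝ) := by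
        ext n
        simp
      rw [this, mul_assoc, ← PowerSeries.invOneSubPow_inv_eq_one_sub_pow]
      simp
    exact Polynomial.coe_injective ℝ ((hf _ ha).symm.trans (hg _ ha))
  have hex : IsVeroneseNumerator r D h
      (contract r (h * (∑ i ∈ Finset.range r, X ^ i) ^ D)) := by
    intro a ha
    have hg : ((∑ i ∈ Finset.range r, X ^ i : ℝ[X]) : PowerSeries ℝ) * (1 - PowerSeries.X) =
        1 - PowerSeries.X ^ r := by
      have := geom_sum_mul_neg (X : ℝ[X]) r
      have h2 := congrArg (fun p : ℝ[X] => (p : PowerSeries ℝ)) this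
      simpa using h2
    have key : PowerSeries.mk a * (1 - (PowerSeries.X : PowerSeries ℝ) ^ r) ^ D =
        ((h * (∑ i ∈ Finset.range r, X ^ i) ^ D : ℝ[X]) : PowerSeries ℝ) := by
      rw [← hg, mul_pow, Polynomial.coe_mul, Polynomial.coe_pow, ← ha]
      ring
    have := section_mul_one_sub_pow hr D (PowerSeries.mk a)
    rw [key] at this
    simp only [PowerSeries.coeff_mk] at this
    rw [← this]
    ext n
    rw [PowerSeries.coeff_mk, Polynomial.coeff_coe, Polynomial.coeff_coe,
      coeff_contract (by omega), mul_comm r n]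
  exact ⟨_, hex, fun f hf => huniq f _ hf hex⟩

/-- The operator `U_r^D` on real polynomials, for `r ≥ 1`: `∑ a_{rn} tⁿ = U_r^D h(t) / (1 - t)^D`
whenever `∑ a_n tⁿ = h(t) / (1 - t)^D`. (The value for `r = 0` is a placeholder.) -/
noncomputable def veroneseU (r D : ℕ) (h : ℝ[X]) : ℝ[X] :=
  if hr : 1 ≤ r then (existsUnique_isVeroneseNumerator hr D h).choose else 0

theorem veroneseU_spec {r : ℕ} (hr : 1 ≤ r) (D : ℕ) (h : ℝ[X]) :
    IsVeroneseNumerator r D h (veroneseU r D h) := by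
  rw [veroneseU, dif_pos hr]
  exact (existsUnique_isVeroneseNumerator hr D h).choose_spec.1

/-- `p(t) = t^m p(1/t)`. The exponent is an integer, so that for `m = -1` only `p = 0` has this
property. -/
def IsSymmetricPoly (m : ℤ) (p : ℝ[X]) : Prop :=
  ∀ x : ℝ, x ≠ 0 → p.eval x = x ^ m * p.eval x⁻¹

/-- `(p, q)` is the symmetric decomposition of `f` with respect to degree `d`. -/
structure IsSymmetricDecomposition (d : ℕ) (f p q : ℝ[X]) : Prop where
  symm_left : IsSymmetricPoly (d : ℤ) p
  symm_right : IsSymmetricPoly ((d : ℤ) - 1) q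
  eq_add : f = p + X * q

/-- The roots of `f`, with multiplicity, in weakly decreasing order. -/
noncomputable def rootsDesc (f : ℝ[X]) : List ℝ :=
  f.roots.sort (· ≥ ·)

/-- `f ⪯ g`: both polynomials are real-rooted, and either one of them is zero or, with
`… ≤ s₂ ≤ s₁` the roots of `f` and `… ≤ t₂ ≤ t₁` those of `g`, the chain
`… ≤ s₂ ≤ t₂ ≤ s₁ ≤ t₁` holds and exhausts both lists. -/
def Interlaces (f g : ℝ[X]) : Prop :=
  f.Splits ∧ g.Splits ∧
    (f = 0 ∨ g = 0 ∨
      (((rootsDesc g).length = (rootsDesc f).length ∨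
          (rootsDesc g).length = (rootsDesc f).length + 1) ∧
        (∀ (i : ℕ) (hf : i < (rootsDesc f).length) (hg : i < (rootsDesc g).length),
          (rootsDesc f)[i] ≤ (rootsDesc g)[i]) ∧
        (∀ (i : ℕ) (hf : i < (rootsDesc f).length) (hg : i + 1 < (rootsDesc g).length),
          (rootsDesc g)[i + 1] ≤ (rootsDesc f)[i])))

/-- All coefficients are nonnegative. -/
def NonnegCoeffs (p : ℝ[X]) : Prop :=
  ∀ i : ℕ, 0 ≤ p.coeff i

/-!
The polynomial `U_r^{d+1} h` is the `r`-th section of `h * G ^ (d + 1)`, where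
`G = 1 + X + ⋯ + X ^ (r - 1)`, and expanding one factor `G` splits it into the sections of
`X ^ k * h * G ^ d` for `0 ≤ k < r`. With `s = deg h` and `e = d + 1 - s`, those with `k < e` add up
to the symmetric part `p` (`decompLeft`), and those with `e ≤ k`, which are divisible by `X`, to
`X * q` (`decompRight`). Symmetry and nonnegativity are then immediate; the interlacing of the roots
is the point.

Fix `x < 0`. The values at `x` of the sections, as a sequence indexed by `k`, extend to a sequence
`Φ_d` on `ℤ` (`sectionSeq`) with `Φ_d (k + r) = x * Φ_d k`, whose second difference on level `d + 2`
is `(x - 1) ^ 2` times the sequence of level `d`. Its symmetrizations `evenSeq` about `N / 2` and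
`oddSeq` about `(N + r) / 2`, where `N = d - s`, determine each other through `evenSeq_add` and
`oddSeq_add` for `x ≠ -1`, and `2 * p` and `2 * q` are sums of their values. By a discrete form of
Rolle's theorem (`OneSignChange.of_second_difference`), used in steps of two levels, the sequence
that runs through `(1 + x) * oddSeq` from right to left and then through `-evenSeq` from left to
right, both on the half period between the two centres, changes sign at most once (`oneSignChange`).

This makes the signs of all values of `evenSeq` and `oddSeq` accessible at the roots of a few
polynomials in `x`. By induction on `d` (`AlternatingRoots`), `oddSeq` at the right end of the half
period has `d - 1` distinct negative roots, at which `evenSeq` at the left end alternates in sign.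
Hence at these roots every sum of values of `evenSeq` that contains the left end alternates, so it
has `d` negative roots that interlace the former; and at those roots, every sum of values of
`oddSeq` that contains the right end alternates in turn (`AlternatingRoots.exists_roots`). On the one
hand this applies to the sums that make up the next level, which is the induction step, and on the
other hand to `p` and `q`, whose roots therefore interlace. The sign of `(1 + x) * oddSeq` needed at
a root is read off by approaching the root from the side of `-1`; at `x = -1` itself each of the two
sequences has constant sign on the half period (`sameSign_neg_one`).

The induction starts at level `1` if `s < r`. If `s = r`, it starts at level `2`, provided that `h`
has a nonzero middle coefficient; the remaining case `h = c * (1 + X ^ r)` is a limit of such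
polynomials (`exists_separatedRoots_of_tendsto`).
-/

/-! ### Sequences with two reflection symmetries -/

/-- The integers of the half period `[N / 2, (N + r) / 2]` between the centres of the two
reflections `j ↦ N - j` and `j ↦ N + r - j`. -/
def HalfPeriod (N r j : ℤ) : Prop := N ≤ 2 * j ∧ 2 * j ≤ N + r

/-- On the half period, `f` does not take a negative value after a positive one. -/
def NoDescent (N r : ℤ) (f : ℤ → ℝ) : Prop :=
  ∀ i j, HalfPeriod N r i → HalfPeriod N r j → i < j → ¬ (0 < f i ∧ f j < 0)

/-- The sequence that runs through `b` from right to left and then through `-e` from left to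
right, both on the half period, has at most one change of sign. -/
def OneSignChange (N r : ℤ) (e b : ℤ → ℝ) : Prop :=
  ∃ s : ℝ, (s = 1 ∨ s = -1) ∧
    (((∀ j, HalfPeriod N r j → 0 ≤ s * b j) ∧ NoDescent N r (fun j => s * e j)) ∨
      ((∀ j, HalfPeriod N r j → 0 ≤ s * e j) ∧ NoDescent N r (fun j => s * b j)))

namespace OneSignChange

theorem neg {N r : ℤ} {e b : ℤ → ℝ} (h : OneSignChange N r e b) :
    OneSignChange N r (fun j => -e j) (fun j => -b j) := by
  obtain ⟨s, hs, h⟩ := h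
  refine ⟨-s, by rcases hs with rfl | rfl <;> simp, ?_⟩
  simpa [neg_mul_neg] using h

/-- Reversing the index exchanges the roles of the two sequences, up to a sign. -/
theorem dual {N r : ℤ} {e b : ℤ → ℝ} (h : OneSignChange N r e b) :
    OneSignChange (-(N + r)) r (fun j => b (-j)) (fun j => -e (-j)) := by
  have hD : ∀ j, HalfPeriod (-(N + r)) r j → HalfPeriod N r (-j) := by
    intro j hj; unfold HalfPeriod at *; omega
  obtain ⟨s, hs, ⟨h1, h2⟩ | ⟨h1, h2⟩⟩ := h
  · refine ⟨s, hs, Or.inr ⟨fun j hj => h1 _ (hD j hj), fun i j hi hj hij hc => ?_⟩⟩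
    refine h2 (-j) (-i) (hD j hj) (hD i hi) (by omega) ⟨?_, ?_⟩ <;> simp only at hc ⊢ <;>
      linarith [hc.1, hc.2]
  · refine ⟨-s, by rcases hs with rfl | rfl <;> simp, Or.inl ⟨fun j hj => ?_,
      fun i j hi hj hij hc => ?_⟩⟩
    · have := h1 _ (hD j hj); simp only at this ⊢; linarith
    · refine h2 (-j) (-i) (hD j hj) (hD i hi) (by omega) ⟨?_, ?_⟩ <;> simp only at hc ⊢ <;>
        linarith [hc.1, hc.2]

theorem of_dual {N r : ℤ} {e b : ℤ → ℝ}
    (h : OneSignChange (-(N + r)) r (fun j => b (-j)) (fun j => -e (-j))) :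
    OneSignChange N r e b := by
  have := h.dual.neg
  simpa [show -(-(N + r) + r) = N by ring] using this

/-- If `e` at the left end and `b` at the right end of the half period have the same sign, then all
of `e` has that sign: there is no room for another change of sign. -/
theorem left_mul_nonneg {N r m M : ℤ} {e b : ℤ → ℝ} (h : OneSignChange N r e b)
    (hm : HalfPeriod N r m) (hm' : 2 * m ≤ N + 1) (hM : HalfPeriod N r M)
    (hpos : 0 < b M * e m) {j : ℤ} (hj : HalfPeriod N r j) : 0 ≤ e j * e m := by
  obtain ⟨s, hs, ⟨h1, h2⟩ | ⟨h1, h2⟩⟩ := h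
  · have hsm : 0 < s * e m := by
      have h3 := h1 M hM
      rcases hs with rfl | rfl
      · have : 0 < e m := by by_contra hc; nlinarith
        linarith
      · have : e m < 0 := by by_contra hc; nlinarith
        linarith
    have hmj : m ≤ j := by unfold HalfPeriod at *; omega
    rcases hmj.eq_or_lt with rfl | hmj
    · exact mul_self_nonneg _
    · have h3 : 0 ≤ s * e j := by
        by_contra hc
        exact h2 m j hm hj hmj ⟨hsm, not_le.1 hc⟩
      have h4 := mul_nonneg h3 hsm.le
      rcases hs with rfl | rfl <;> linarith
  · have h4 := mul_nonneg (h1 j hj) (h1 m hm)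
    rcases hs with rfl | rfl <;> linarith

/-- If `b` at the right end of the half period and some value of `e` have opposite signs, then the
change of sign lies within `e`, and all of `b` has the same sign. -/
theorem right_mul_nonneg {N r i M : ℤ} {e b : ℤ → ℝ} (h : OneSignChange N r e b)
    (hi : HalfPeriod N r i) (hM : HalfPeriod N r M) (hM' : N + r ≤ 2 * M + 1)
    (hneg : e i * b M < 0) {j : ℤ} (hj : HalfPeriod N r j) : 0 ≤ b j * b M := by
  obtain ⟨s, hs, ⟨h1, h2⟩ | ⟨h1, h2⟩⟩ := h
  · have h4 := mul_nonneg (h1 j hj) (h1 M hM)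
    rcases hs with rfl | rfl <;> linarith
  · have hsM : s * b M < 0 := by
      have h3 := h1 i hi
      rcases hs with rfl | rfl
      · have : b M < 0 := by by_contra hc; nlinarith
        linarith
      · have : 0 < b M := by by_contra hc; nlinarith
        linarith
    have hjM : j ≤ M := by unfold HalfPeriod at *; omega
    rcases hjM.eq_or_lt with rfl | hjM
    · exact mul_self_nonneg _
    · have h3 : s * b j ≤ 0 := by
        by_contra hc
        exact h2 j M hj hM hjM ⟨not_le.1 hc, hsM⟩
      have h4 := mul_nonneg_of_nonpos_of_nonpos h3 hsM.le
      rcases hs with rfl | rfl <;> linarith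

theorem shift {N r : ℤ} {e b : ℤ → ℝ}
    (h : OneSignChange N r (fun j => e (j + 1)) (fun j => b (j + 1))) :
    OneSignChange (N + 2) r e b := by
  have hD : ∀ j, HalfPeriod (N + 2) r j → HalfPeriod N r (j - 1) := by
    intro j hj; unfold HalfPeriod at *; omega
  have key : ∀ c : ℤ → ℝ, NoDescent N r (fun j => c (j + 1)) → NoDescent (N + 2) r c := by
    intro c hc i j hi hj hij
    have := hc (i - 1) (j - 1) (hD i hi) (hD j hj) (by omega)
    simpa using this
  obtain ⟨s, hs, ⟨h1, h2⟩ | ⟨h1, h2⟩⟩ := h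
  · exact ⟨s, hs, Or.inl ⟨fun j hj => by simpa using h1 _ (hD j hj), key _ h2⟩⟩
  · exact ⟨s, hs, Or.inr ⟨fun j hj => by simpa using h1 _ (hD j hj), key _ h2⟩⟩

end OneSignChange

/-- A pair of sequences, `a` symmetric about `N / 2` and `b` symmetric about `(N + r) / 2`, each
of which is up to a factor the symmetrization of the other. -/
structure FoldedPair (N r : ℤ) (η θ : ℝ) (a b : ℤ → ℝ) : Prop where
  symm_left : ∀ j, a (N - j) = a j
  symm_right : ∀ j, b (N + r - j) = b j
  add_left : ∀ j, a j + a (N + r - j) = η * b j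
  add_right : ∀ j, b j + b (N - j) = -(θ * a j)

namespace FoldedPair

variable {N r : ℤ} {η θ : ℝ} {a b : ℤ → ℝ}

theorem dual (h : FoldedPair N r η θ a b) :
    FoldedPair (-(N + r)) r θ η (fun j => b (-j)) (fun j => -a (-j)) where
  symm_left j := by
    have := h.symm_right (-j)
    rwa [show N + r - -j = -(-(N + r) - j) by ring] at this
  symm_right j := by
    have := h.symm_left (-j)
    rw [show N - -j = -(-(N + r) + r - j) by ring] at this
    exact congrArg Neg.neg this
  add_left j := by
    have := h.add_right (-j)
    simp only [show -(-(N + r) + r - j) = N - -j by ring]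
    linarith
  add_right j := by
    have := h.add_left (-j)
    simp only [show -(-(N + r) - j) = N + r - -j by ring]
    linarith

theorem neg (h : FoldedPair N r η θ a b) :
    FoldedPair N r η θ (fun j => -a j) (fun j => -b j) where
  symm_left j := by simp [h.symm_left j]
  symm_right j := by simp [h.symm_right j]
  add_left j := by linarith [h.add_left j]
  add_right j := by linarith [h.add_right j]

theorem shift (h : FoldedPair (N + 2) r η θ a b) :
    FoldedPair N r η θ (fun j => a (j + 1)) (fun j => b (j + 1)) where
  symm_left j := by rw [← h.symm_left]; congr 1; ring
  symm_right j := by rw [← h.symm_right]; congr 1; ring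
  add_left j := by rw [← h.add_left]; congr 2; ring
  add_right j := by rw [← h.add_right]; congr 2; ring

end FoldedPair

theorem diff_le_diff {c g : ℤ → ℝ} {K : ℝ} (hK : 0 ≤ K)
    (hc : ∀ j, c (j + 1) - 2 * c j + c (j - 1) = K * g j) {l k : ℤ} (hlk : l ≤ k)
    (hg : ∀ i, l < i → i ≤ k → 0 ≤ g i) : c (l + 1) - c l ≤ c (k + 1) - c k := by
  induction k, hlk using Int.leInduction with
  | base => exact le_rfl
  | succ k hk ih =>
    have h1 := ih fun i hi hik => hg i hi (by omega)
    have h2 := hc (k + 1)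
    have h3 := mul_nonneg hK (hg (k + 1) (by omega) le_rfl)
    rw [add_sub_cancel_right] at h2
    linarith

theorem le_of_diff_nonneg {c : ℤ → ℝ} {l k : ℤ} (hlk : l ≤ k)
    (hd : ∀ i, l ≤ i → i < k → 0 ≤ c (i + 1) - c i) : c l ≤ c k := by
  induction k, hlk using Int.leInduction with
  | base => exact le_rfl
  | succ k hk ih =>
    have h1 := ih fun i hi hik => hd i hi (by omega)
    linarith [hd k hk (by omega)]

theorem exists_diff_pos {c : ℤ → ℝ} {l k : ℤ} (hlk : l ≤ k) (h : c l < c k) :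
    ∃ i, l ≤ i ∧ i < k ∧ 0 < c (i + 1) - c i := by
  by_contra hcon
  push Not at hcon
  have := le_of_diff_nonneg (c := fun i => -c i) hlk fun i hi hik => by
    have := hcon i hi hik
    linarith
  linarith

/-- A sequence symmetric about `M / 2` whose second difference is nonnegative near the centre
decreases up to the centre. -/
theorem antitone_of_symm_convex {c g : ℤ → ℝ} {K : ℝ} {M l k : ℤ} (hK : 0 ≤ K)
    (hc : ∀ j, c (j + 1) - 2 * c j + c (j - 1) = K * g j) (hsymm : ∀ j, c (M - j) = c j)
    (hg : ∀ i, l < i → i < M - l → 0 ≤ g i) (hlk : l ≤ k) (hk : 2 * k ≤ M + 1) :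
    c k ≤ c l := by
  have := le_of_diff_nonneg (c := fun i => -c i) hlk fun i hi hik => by
    have h1 := diff_le_diff hK hc (l := i) (k := M - 1 - i) (by omega)
      fun j hj hj' => hg j (by omega) (by omega)
    have h2 := hsymm i
    have h3 := hsymm (i + 1)
    rw [show M - 1 - i + 1 = M - i by ring, show M - 1 - i = M - (i + 1) by ring] at h1
    linarith
  linarith

/-- If the second difference of a sequence symmetric about `N / 2` is `K * e`, with `e` negative
first and positive later, then beyond the centre the sequence first decreases and then increases
for good. -/
theorem le_of_lt_of_noDescent {N r : ℤ} {K : ℝ} {a e : ℤ → ℝ} (hK : 0 ≤ K)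
    (hsymm : ∀ j, a (N - j) = a j) (hesymm : ∀ j, e (N - j) = e j)
    (ha : ∀ j, a (j + 1) - 2 * a j + a (j - 1) = K * e j) (he : NoDescent N r e)
    {i j k : ℤ} (hi : N ≤ 2 * i) (hij : i < j) (hlt : a i < a j) (hjk : j ≤ k)
    (hk : 2 * k ≤ N + r + 2) : a j ≤ a k := by
  obtain ⟨l, hil, hlj, hl⟩ := exists_diff_pos hij.le hlt
  by_cases hlD : 2 * l ≤ N + r
  swap
  · obtain rfl : j = k := by omega
    exact le_rfl
  obtain ⟨n, hn1, hn2, hn⟩ : ∃ n, N - l ≤ n ∧ n ≤ l ∧ 0 < e n := by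
    by_contra hcon
    push Not at hcon
    have h1 := diff_le_diff (c := fun j => -a j) (g := fun j => -e j) hK
      (fun j => by linarith [ha j]) (l := N - 1 - l) (k := l) (by omega)
      (fun i hi hil => by linarith [hcon i (by omega) hil])
    have h2 := hsymm l
    have h3 := hsymm (l + 1)
    rw [show N - 1 - l + 1 = N - l by ring, show N - 1 - l = N - (l + 1) by ring] at h1
    linarith
  obtain ⟨n', hn'D, hn'l, hn'⟩ : ∃ n', N ≤ 2 * n' ∧ n' ≤ l ∧ 0 < e n' := by
    by_cases hnN : N ≤ 2 * n
    · exact ⟨n, hnN, hn2, hn⟩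
    · exact ⟨N - n, by omega, by omega, by rwa [hesymm]⟩
  refine le_of_diff_nonneg hjk fun t ht htk => ?_
  have := diff_le_diff hK ha (l := l) (k := t) (by omega) fun i hi hit => by
    have := he n' i ⟨hn'D, by omega⟩ ⟨by omega, by omega⟩ (by omega)
    push Not at this
    exact this hn'
  linarith

/-- The case of `OneSignChange.of_second_difference` in which the change of sign lies within `e`.
-/
theorem OneSignChange.of_right_nonneg {N r : ℤ} {η θ K : ℝ} {a b e f : ℤ → ℝ} (hr : 0 ≤ r)
    (hη : 0 ≤ η) (hθ : 0 ≤ θ) (hK : 0 ≤ K) (hab : FoldedPair N r η θ a b)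
    (hesymm : ∀ j, e (N - j) = e j) (hfsymm : ∀ j, f (N + r - j) = f j)
    (ha : ∀ j, a (j + 1) - 2 * a j + a (j - 1) = K * e j)
    (hb : ∀ j, b (j + 1) - 2 * b j + b (j - 1) = K * f j)
    (hf : ∀ j, HalfPeriod N r j → 0 ≤ f j) (he : NoDescent N r e) : OneSignChange N r a b := by
  have hf' : ∀ j, N ≤ 2 * j → 2 * j ≤ N + 2 * r → 0 ≤ f j := by
    intro j h1 h2
    by_cases h : 2 * j ≤ N + r
    · exact hf j ⟨h1, h⟩
    · rw [← hfsymm]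
      exact hf _ ⟨by omega, by omega⟩
  have hbanti : ∀ l k, N - 2 ≤ 2 * l → l ≤ k → 2 * k ≤ N + r + 1 → b k ≤ b l := by
    intro l k hl hlk hk
    exact antitone_of_symm_convex hK hb hab.symm_right
      (fun i hi hi' => hf' i (by omega) (by omega)) hlk hk
  have hainc : ∀ i j k, N ≤ 2 * i → i < j → a i < a j → j ≤ k → 2 * k ≤ N + r + 2 →
      a j ≤ a k := fun i j k hi hij hlt hjk hk =>
    le_of_lt_of_noDescent hK hab.symm_left hesymm ha he hi hij hlt hjk hk
  obtain ⟨M, hM1, hM2⟩ : ∃ M : ℤ, 2 * M ≤ N + r ∧ N + r ≤ 2 * M + 1 := ⟨(N + r) / 2, by omega⟩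
  obtain ⟨m, hm1, hm2⟩ : ∃ m : ℤ, N ≤ 2 * m ∧ 2 * m ≤ N + 1 := ⟨(N + 1) / 2, by omega⟩
  have hend : ∀ i j, HalfPeriod N r i → HalfPeriod N r j → i < j → a i < a j →
      2 * a j ≤ η * b M := by
    intro i j hi hj hij hlt
    unfold HalfPeriod at *
    rw [← hab.add_left]
    linarith [hainc i j M hi.1 hij hlt (by omega) (by omega),
      hainc i j (N + r - M) hi.1 hij hlt (by omega) (by omega)]
  by_cases hneg : ∀ j, HalfPeriod N r j → b j ≤ 0
  · refine ⟨-1, Or.inr rfl, Or.inl ⟨fun j hj => by linarith [hneg j hj],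
      fun i j hi hj hij hc => ?_⟩⟩
    simp only at hc
    have h1 := hend i j hi hj hij (by linarith [hc.1, hc.2])
    have h2 : b M ≤ 0 := hneg M ⟨by unfold HalfPeriod at *; omega, hM1⟩
    have h3 := mul_nonneg hη (neg_nonneg.2 h2)
    linarith [hc.2]
  push Not at hneg
  obtain ⟨j₀, hj₀, hpos⟩ := hneg
  unfold HalfPeriod at hj₀
  have ham : a m < 0 := by
    have h1 := hbanti m j₀ (by omega) (by omega) (by omega)
    have h2 := hbanti (N - m) m (by omega) (by omega) (by omega)
    have h3 := hab.add_right m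
    by_contra hcon
    have := mul_nonneg hθ (not_lt.1 hcon)
    linarith
  have hmj : ∀ j, HalfPeriod N r j → 0 < a j → m < j := by
    intro j hj hpos
    unfold HalfPeriod at hj
    refine lt_of_le_of_ne (by omega) ?_
    rintro rfl
    linarith
  have hmD : HalfPeriod N r m := ⟨hm1, by omega⟩
  by_cases hbpos : ∀ j, HalfPeriod N r j → 0 ≤ b j
  · refine ⟨1, Or.inl rfl, Or.inl ⟨fun j hj => by linarith [hbpos j hj],
      fun i j hi hj hij hc => ?_⟩⟩
    simp only [one_mul] at hc
    have := hainc m i j hm1 (hmj i hi hc.1) (by linarith [hc.1]) hij.le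
      (by unfold HalfPeriod at *; omega)
    linarith [hc.1, hc.2]
  · push Not at hbpos
    obtain ⟨j₁, hj₁, hneg⟩ := hbpos
    unfold HalfPeriod at hj₁
    refine ⟨-1, Or.inr rfl, Or.inr ⟨fun j hj => ?_, fun i j hi hj hij hc => ?_⟩⟩
    · by_contra hcon
      have hj' : 0 < a j := by linarith
      have h1 := hend m j hmD hj (hmj j hj hj') (by linarith)
      have h2 := hbanti j₁ M (by omega) (by omega) (by omega)
      have h3 : 0 ≤ η * -b M := mul_nonneg hη (by linarith)
      linarith
    · unfold HalfPeriod at hi hj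
      have := hbanti i j (by omega) hij.le (by omega)
      simp only at hc
      linarith [hc.1, hc.2]

/-- If the second differences of a folded pair form, up to a nonnegative factor, a pair with one
sign change, then the pair has one sign change: a discrete form of Rolle's theorem. -/
theorem OneSignChange.of_second_difference {N r : ℤ} {η θ K : ℝ} {a b e f : ℤ → ℝ} (hr : 0 ≤ r)
    (hη : 0 ≤ η) (hθ : 0 ≤ θ) (hK : 0 ≤ K) (hab : FoldedPair N r η θ a b)
    (hesymm : ∀ j, e (N - j) = e j) (hfsymm : ∀ j, f (N + r - j) = f j)
    (ha : ∀ j, a (j + 1) - 2 * a j + a (j - 1) = K * e j)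
    (hb : ∀ j, b (j + 1) - 2 * b j + b (j - 1) = K * f j)
    (h : OneSignChange N r e f) : OneSignChange N r a b := by
  obtain ⟨s, hs, ⟨h1, h2⟩ | ⟨h1, h2⟩⟩ := h
  · rcases hs with rfl | rfl
    · exact of_right_nonneg hr hη hθ hK hab hesymm hfsymm ha hb (by simpa using h1)
        (by simpa using h2)
    · have := (of_right_nonneg (e := fun j => -e j) (f := fun j => -f j) hr hη hθ hK hab.neg
        (by simpa using hesymm) (by simpa using hfsymm) (fun j => by linarith [ha j])
        (fun j => by linarith [hb j]) (by simpa using h1) (by simpa using h2)).neg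
      simpa using this
  · have key : ∀ {a b e f : ℤ → ℝ}, FoldedPair N r η θ a b → (∀ j, e (N - j) = e j) →
        (∀ j, f (N + r - j) = f j) → (∀ j, a (j + 1) - 2 * a j + a (j - 1) = K * e j) →
        (∀ j, b (j + 1) - 2 * b j + b (j - 1) = K * f j) →
        (∀ j, HalfPeriod N r j → 0 ≤ -e j) → NoDescent N r (fun j => -f j) →
        OneSignChange N r a b := by
      intro a b e f hab hesymm hfsymm ha hb he hf
      have hD : ∀ j, HalfPeriod (-(N + r)) r j → HalfPeriod N r (-j) := by
        intro j hj; unfold HalfPeriod at *; omega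
      refine OneSignChange.of_dual (of_right_nonneg (e := fun j => f (-j))
        (f := fun j => -e (-j)) hr hθ hη hK hab.dual (fun j => ?_) (fun j => ?_) (fun j => ?_)
        (fun j => ?_) (fun j hj => he _ (hD j hj)) (fun i j hi hj hij hc => ?_))
      · have := hfsymm (-j)
        rwa [show N + r - -j = -(-(N + r) - j) by ring] at this
      · have := hesymm (-j)
        rw [show N - -j = -(-(N + r) + r - j) by ring] at this
        exact congrArg Neg.neg this
      · have := hb (-j)
        simp only [show -(j + 1) = -j - 1 by ring, show -(j - 1) = -j + 1 by ring]
        linarith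
      · have := ha (-j)
        simp only [show -(j + 1) = -j - 1 by ring, show -(j - 1) = -j + 1 by ring]
        linarith
      · refine hf (-j) (-i) (hD j hj) (hD i hi) (by omega) ⟨?_, ?_⟩ <;> simp only <;>
          linarith [hc.1, hc.2]
    rcases hs with rfl | rfl
    · have := (key hab.neg (e := fun j => -e j) (f := fun j => -f j) (by simpa using hesymm)
        (by simpa using hfsymm) (fun j => by linarith [ha j])
        (fun j => by linarith [hb j]) (by simpa using h1) (by simpa using h2)).neg
      simpa using this
    · exact key hab hesymm hfsymm ha hb (by simpa using h1) (by simpa using h2)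

/-- A sequence symmetric about `N / 2` and antisymmetric about `(N + r) / 2` is nonpositive on the
half period if its second difference is nonnegative there. -/
theorem nonpos_of_symm_antisymm {N r : ℤ} {K : ℝ} {a e : ℤ → ℝ} (hK : 0 ≤ K)
    (hsymm : ∀ j, a (N - j) = a j) (hanti : ∀ j, a j + a (N + r - j) = 0)
    (hesymm : ∀ j, e (N - j) = e j)
    (ha : ∀ j, a (j + 1) - 2 * a j + a (j - 1) = K * e j)
    (he : ∀ j, HalfPeriod N r j → 0 ≤ e j) : ∀ j, HalfPeriod N r j → a j ≤ 0 := by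
  have he' : ∀ j, N - r ≤ 2 * j → 2 * j ≤ N + r → 0 ≤ e j := by
    intro j h1 h2
    by_cases h : N ≤ 2 * j
    · exact he j ⟨h, h2⟩
    · rw [← hesymm]
      exact he _ ⟨by omega, by omega⟩
  have hmono : ∀ l k, N ≤ 2 * l + 1 → l ≤ k → 2 * k ≤ N + r + 2 → a l ≤ a k := by
    intro l k hl hlk hk
    refine le_of_diff_nonneg hlk fun i hi hik => ?_
    have h1 := diff_le_diff hK ha (l := N - 1 - i) (k := i) (by omega)
      fun t ht ht' => he' t (by omega) (by omega)
    have h2 := hsymm i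
    have h3 := hsymm (i + 1)
    rw [show N - 1 - i + 1 = N - i by ring, show N - 1 - i = N - (i + 1) by ring] at h1
    linarith
  intro j hj
  unfold HalfPeriod at hj
  have := hmono j (N + r - j) (by omega) (by omega)
  have h3 := hanti j
  by_cases h4 : 2 * (N + r - j) ≤ N + r + 2
  · linarith [this h4]
  · have h5 := hmono j ((N + r) / 2) (by omega) (by omega) (by omega)
    have h6 := hmono j (N + r - (N + r) / 2) (by omega) (by omega) (by omega)
    have h7 := hanti ((N + r) / 2)
    linarith

/-- The strict form of `nonpos_of_symm_antisymm` at the centre. -/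
theorem neg_of_symm_antisymm {N r : ℤ} {K : ℝ} {a e : ℤ → ℝ} (hK : 0 < K)
    (hsymm : ∀ j, a (N - j) = a j) (hanti : ∀ j, a j + a (N + r - j) = 0)
    (hesymm : ∀ j, e (N - j) = e j)
    (ha : ∀ j, a (j + 1) - 2 * a j + a (j - 1) = K * e j)
    (he : ∀ j, HalfPeriod N r j → 0 ≤ e j) {i m : ℤ} (hi : N ≤ 2 * i) (hir : 2 * i < N + r)
    (hei : 0 < e i) (hm : N ≤ 2 * m) (hm' : 2 * m ≤ N + 1) : a m < 0 := by
  have hnonpos := nonpos_of_symm_antisymm hK.le hsymm hanti hesymm ha he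
  have he' : ∀ j, N - r ≤ 2 * j → 2 * j ≤ N + r → 0 ≤ e j := by
    intro j h1 h2
    by_cases h : N ≤ 2 * j
    · exact he j ⟨h, h2⟩
    · rw [← hesymm]
      exact he _ ⟨by omega, by omega⟩
  have hstep : ∀ l, N ≤ 2 * l + 1 → 2 * l ≤ N + r → a l ≤ a (l + 1) := by
    intro l hl hl'
    have h1 := diff_le_diff hK.le ha (l := N - 1 - l) (k := l) (by omega)
      fun t ht ht' => he' t (by omega) (by omega)
    have h2 := hsymm l
    have h3 := hsymm (l + 1)
    rw [show N - 1 - l + 1 = N - l by ring, show N - 1 - l = N - (l + 1) by ring] at h1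
    linarith
  by_contra hcon
  -- Otherwise the sequence vanishes on the half period, and so does its second difference at `i`.
  have hmono : ∀ k, m ≤ k → 2 * k ≤ N + r + 2 → 0 ≤ a k := by
    intro k hk hk2
    have := le_of_diff_nonneg (c := a) hk fun t ht htk => by
      linarith [hstep t (by omega) (by omega)]
    linarith
  have hzero : ∀ k, m ≤ k → 2 * k ≤ N + r + 1 → a k = 0 := by
    intro k hk hk2
    refine le_antisymm ?_ (hmono k hk (by omega))
    by_cases h : 2 * k ≤ N + r
    · exact hnonpos k ⟨by omega, h⟩
    · have h1 := hanti k
      have h2 := hmono (N + r - k) (by omega) (by omega)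
      linarith
  have hi1 : a i = 0 := hzero i (by omega) (by omega)
  have hi2 : a (i + 1) = 0 := hzero (i + 1) (by omega) (by omega)
  have hi3 : a (i - 1) = 0 := by
    by_cases h : m ≤ i - 1
    · exact hzero _ h (by omega)
    · rw [← hsymm]
      exact hzero _ (by omega) (by omega)
  have := ha i
  rw [hi1, hi2, hi3] at this
  have := mul_pos hK hei
  linarith

/-! ### The sections of `h * (1 + ⋯ + X ^ (r - 1)) ^ d` at a fixed argument -/

section

/-- For `j ≥ 0`, this is the value at `x` of the polynomial whose `n`-th coefficient is the
coefficient at `r * n` of `X ^ j * h * (1 + ⋯ + X ^ (r - 1)) ^ d`. Negative powers of `x` make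
sense of it for all integers `j`. -/
noncomputable def sectionSeq (h : ℝ[X]) (r : ℕ) (x : ℝ) : ℕ → ℤ → ℝ
  | 0, j => ∑ k ∈ Finset.range (h.natDegree + 1),
      if (r : ℤ) ∣ j + k then h.coeff k * x ^ ((j + k) / (r : ℤ)) else 0
  | d + 1, j => ∑ m ∈ Finset.range r, sectionSeq h r x d (j + m)

variable {h : ℝ[X]} {r : ℕ} {x : ℝ}

theorem sectionSeq_add_period (hr : r ≠ 0) (hx : x ≠ 0) (d : ℕ) (j : ℤ) :
    sectionSeq h r x d (j + r) = x * sectionSeq h r x d j := by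
  induction d generalizing j with
  | zero =>
    simp only [sectionSeq, Finset.mul_sum]
    refine Finset.sum_congr rfl fun k _ => ?_
    have hr' : (r : ℤ) ≠ 0 := by exact_mod_cast hr
    have h1 : j + r + k = (j + k) + r := by ring
    rw [h1, Int.add_ediv_of_dvd_right dvd_rfl, Int.ediv_self hr']
    simp only [dvd_add_self_right]
    split_ifs
    · rw [zpow_add_one₀ hx]; ring
    · simp
  | succ d ih =>
    simp only [sectionSeq, Finset.mul_sum]
    refine Finset.sum_congr rfl fun m _ => ?_
    rw [← ih]
    congr 1
    ring

theorem sectionSeq_sub_period (hr : r ≠ 0) (hx : x ≠ 0) (d : ℕ) (j : ℤ) :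
    x * sectionSeq h r x d (j - r) = sectionSeq h r x d j := by
  rw [← sectionSeq_add_period hr hx, sub_add_cancel]

theorem sectionSeq_succ_sub (hr : r ≠ 0) (hx : x ≠ 0) (d : ℕ) (j : ℤ) :
    sectionSeq h r x (d + 1) (j + 1) - sectionSeq h r x (d + 1) j =
      (x - 1) * sectionSeq h r x d j := by
  have h1 : ∑ m ∈ Finset.range (r + 1), sectionSeq h r x d (j + m) =
      sectionSeq h r x (d + 1) (j + 1) + sectionSeq h r x d j := by
    rw [Finset.sum_range_succ']
    simp only [sectionSeq, Nat.cast_add, Nat.cast_one, Nat.cast_zero, add_zero]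
    congr 1
    refine Finset.sum_congr rfl fun m _ => ?_
    congr 1
    ring
  have h2 : ∑ m ∈ Finset.range (r + 1), sectionSeq h r x d (j + m) =
      sectionSeq h r x (d + 1) j + x * sectionSeq h r x d j := by
    rw [Finset.sum_range_succ, sectionSeq_add_period hr hx]
    rfl
  linarith

theorem sectionSeq_second_difference (hr : r ≠ 0) (hx : x ≠ 0) (d : ℕ) (j : ℤ) :
    sectionSeq h r x (d + 2) (j + 2) - 2 * sectionSeq h r x (d + 2) (j + 1) +
      sectionSeq h r x (d + 2) j = (x - 1) ^ 2 * sectionSeq h r x d j := by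
  have h1 := sectionSeq_succ_sub (h := h) hr hx (d + 1) (j + 1)
  have h2 := sectionSeq_succ_sub (h := h) hr hx (d + 1) j
  have h3 := sectionSeq_succ_sub (h := h) hr hx d j
  rw [show j + 1 + 1 = j + 2 by ring] at h1
  linear_combination h1 - h2 + (x - 1) * h3

theorem sectionSeq_inv (hr : r ≠ 0) (hx : x ≠ 0)
    (hpal : ∀ k ≤ h.natDegree, h.coeff (h.natDegree - k) = h.coeff k) (d : ℕ) (j : ℤ) :
    x ^ d * sectionSeq h r x⁻¹ d j = sectionSeq h r x d (d - h.natDegree - j) := by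
  induction d generalizing j with
  | zero =>
    simp only [sectionSeq, pow_zero, one_mul]
    rw [← Finset.sum_range_reflect]
    refine Finset.sum_congr rfl fun k hk => ?_
    have hk' : k ≤ h.natDegree := by simpa [Nat.lt_succ_iff] using hk
    have h1 : h.natDegree + 1 - 1 - k = h.natDegree - k := by omega
    have h2 : j + ((h.natDegree - k : ℕ) : ℤ) =
        -(((0 : ℕ) : ℤ) - h.natDegree - j + k) := by push_cast [Nat.cast_sub hk']; ring
    rw [h1, hpal k hk', h2]
    simp only [dvd_neg]
    split_ifs with hd
    · rw [Int.neg_ediv_of_dvd hd, inv_zpow, zpow_neg, inv_inv]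
    · rfl
  | succ d ih =>
    simp only [sectionSeq, Finset.mul_sum]
    rw [← Finset.sum_range_reflect]
    refine Finset.sum_congr rfl fun m hm => ?_
    have hm' : m < r := by simpa using hm
    have h1 : (j : ℤ) + ((r - 1 - m : ℕ) : ℤ) = j + r - 1 - m := by
      push_cast [Nat.cast_sub (show m ≤ r - 1 by omega), Nat.cast_sub (show 1 ≤ r by omega)]
      ring
    rw [h1, pow_succ', mul_assoc, ih, ← sectionSeq_add_period hr hx]
    congr 1
    push_cast
    ring

theorem continuousAt_sectionSeq {x₀ : ℝ} (hx₀ : x₀ ≠ 0) (d : ℕ) (j : ℤ) :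
    ContinuousAt (fun x => sectionSeq h r x d j) x₀ := by
  induction d generalizing j with
  | zero =>
    simp only [sectionSeq]
    refine tendsto_finsetSum _ fun k _ => ?_
    split_ifs
    · exact (continuousAt_const.mul (continuousAt_zpow₀ _ _ (Or.inl hx₀)))
    · exact continuousAt_const
  | succ d ih =>
    simp only [sectionSeq]
    exact tendsto_finsetSum _ fun m _ => ih _

/-- The symmetrization of `sectionSeq` about its centre. -/
noncomputable def evenSeq (h : ℝ[X]) (r : ℕ) (x : ℝ) (d : ℕ) (j : ℤ) : ℝ :=
  sectionSeq h r x d j + sectionSeq h r x d (d - h.natDegree - j)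

/-- The symmetrization of `sectionSeq` about the point half a period before its centre. The
argument is shifted by `r`, so that the sequence is symmetric about the point half a period after
the centre. -/
noncomputable def oddSeq (h : ℝ[X]) (r : ℕ) (x : ℝ) (d : ℕ) (j : ℤ) : ℝ :=
  sectionSeq h r x d (d - h.natDegree - j) + sectionSeq h r x d (j - r)

theorem evenSeq_symm (d : ℕ) (j : ℤ) :
    evenSeq h r x d (d - h.natDegree - j) = evenSeq h r x d j := by
  rw [evenSeq, evenSeq, add_comm, sub_sub_cancel]

theorem oddSeq_symm (d : ℕ) (j : ℤ) :
    oddSeq h r x d (d - h.natDegree + r - j) = oddSeq h r x d j := by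
  rw [oddSeq, oddSeq, add_comm]
  congr 2 <;> ring

theorem evenSeq_add (hr : r ≠ 0) (hx : x ≠ 0) (d : ℕ) (j : ℤ) :
    evenSeq h r x d j + evenSeq h r x d (d - h.natDegree + r - j) =
      (1 + x) * oddSeq h r x d j := by
  have h1 := sectionSeq_sub_period (h := h) hr hx d j
  have h2 := sectionSeq_add_period (h := h) hr hx d (d - h.natDegree - j)
  rw [evenSeq, evenSeq, oddSeq, ← h1,
    show (d : ℤ) - h.natDegree + r - j = d - h.natDegree - j + r by ring, h2,
    show (d : ℤ) - h.natDegree - (d - h.natDegree - j + r) = j - r by ring]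
  ring

theorem oddSeq_add (hr : r ≠ 0) (hx : x ≠ 0) (d : ℕ) (j : ℤ) :
    x * (oddSeq h r x d j + oddSeq h r x d (d - h.natDegree - j)) =
      (1 + x) * evenSeq h r x d j := by
  have h1 := sectionSeq_sub_period (h := h) hr hx d j
  have h2 := sectionSeq_sub_period (h := h) hr hx d (d - h.natDegree - j)
  rw [evenSeq, oddSeq, oddSeq, sub_sub_cancel]
  linear_combination h1 + h2

theorem evenSeq_second_difference (hr : r ≠ 0) (hx : x ≠ 0) (d : ℕ) (j : ℤ) :
    evenSeq h r x (d + 2) (j + 1 + 1) - 2 * evenSeq h r x (d + 2) (j + 1) +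
      evenSeq h r x (d + 2) (j - 1 + 1) = (x - 1) ^ 2 * evenSeq h r x d j := by
  have h1 := sectionSeq_second_difference (h := h) hr hx d j
  have h2 := sectionSeq_second_difference (h := h) hr hx d (d - h.natDegree - j)
  simp only [evenSeq]
  push_cast
  rw [show j + 1 + 1 = j + 2 by ring, show j - 1 + 1 = j by ring,
    show (d : ℤ) + 2 - h.natDegree - (j + 2) = d - h.natDegree - j by ring,
    show (d : ℤ) + 2 - h.natDegree - (j + 1) = d - h.natDegree - j + 1 by ring,
    show (d : ℤ) + 2 - h.natDegree - j = d - h.natDegree - j + 2 by ring]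
  linear_combination h1 + h2

theorem oddSeq_second_difference (hr : r ≠ 0) (hx : x ≠ 0) (d : ℕ) (j : ℤ) :
    oddSeq h r x (d + 2) (j + 1 + 1) - 2 * oddSeq h r x (d + 2) (j + 1) +
      oddSeq h r x (d + 2) (j - 1 + 1) = (x - 1) ^ 2 * oddSeq h r x d j := by
  have h1 := sectionSeq_second_difference (h := h) hr hx d (j - r)
  have h2 := sectionSeq_second_difference (h := h) hr hx d (d - h.natDegree - j)
  simp only [oddSeq]
  push_cast
  rw [show j + 1 + 1 - r = j - r + 2 by ring, show j + 1 - r = j - r + 1 by ring,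
    show j - 1 + 1 - r = j - r by ring,
    show (d : ℤ) + 2 - h.natDegree - (j + 1 + 1) = d - h.natDegree - j by ring,
    show (d : ℤ) + 2 - h.natDegree - (j + 1) = d - h.natDegree - j + 1 by ring,
    show (d : ℤ) + 2 - h.natDegree - (j - 1 + 1) = d - h.natDegree - j + 2 by ring]
  linear_combination h1 + h2

theorem oddSeq_inv (hr : r ≠ 0) (hx : x ≠ 0)
    (hpal : ∀ k ≤ h.natDegree, h.coeff (h.natDegree - k) = h.coeff k) (d : ℕ) (j : ℤ) :
    x ^ d * oddSeq h r x⁻¹ d j = x * oddSeq h r x d j := by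
  rw [oddSeq, oddSeq, mul_add, sectionSeq_inv hr hx hpal, sectionSeq_inv hr hx hpal,
    mul_add, sectionSeq_sub_period hr hx, ← sectionSeq_add_period hr hx, add_comm]
  congr 2 <;> ring

/-- Summing `evenSeq` over a period gives `oddSeq` on the next level. -/
theorem oddSeq_succ (d : ℕ) (j : ℤ) :
    oddSeq h r x (d + 1) j = ∑ m ∈ Finset.range r, evenSeq h r x d (j - r + m) := by
  simp only [oddSeq, evenSeq, sectionSeq, Finset.sum_add_distrib]
  rw [add_comm]
  congr 1
  rw [← Finset.sum_range_reflect]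
  refine Finset.sum_congr rfl fun m hm => ?_
  have hm' : m < r := by simpa using hm
  congr 1
  push_cast [Nat.cast_sub (show m ≤ r - 1 by omega), Nat.cast_sub (show 1 ≤ r by omega)]
  ring

/-- Summing `oddSeq` over a period gives `evenSeq` on the next level, up to the factor `x`. -/
theorem evenSeq_succ (hr : r ≠ 0) (hx : x ≠ 0) (d : ℕ) (j : ℤ) :
    evenSeq h r x (d + 1) j = x * ∑ m ∈ Finset.range r, oddSeq h r x d (j + m) := by
  simp only [oddSeq, evenSeq, sectionSeq, Finset.sum_add_distrib, mul_add, Finset.mul_sum,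
    sectionSeq_sub_period hr hx]
  rw [add_comm]
  congr 1
  rw [← Finset.sum_range_reflect]
  refine Finset.sum_congr rfl fun m hm => ?_
  have hm' : m < r := by simpa using hm
  rw [← sectionSeq_add_period hr hx]
  congr 1
  push_cast [Nat.cast_sub (show m ≤ r - 1 by omega), Nat.cast_sub (show 1 ≤ r by omega)]
  ring

theorem foldedPair (hr : r ≠ 0) (hx : x ≠ 0) (d : ℕ) :
    FoldedPair (d - h.natDegree) r 1 (-((1 + x) ^ 2 / x)) (evenSeq h r x d)
      (fun j => (1 + x) * oddSeq h r x d j) where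
  symm_left j := evenSeq_symm d j
  symm_right j := by rw [oddSeq_symm]
  add_left j := by rw [evenSeq_add hr hx, one_mul]
  add_right j := by
    have := oddSeq_add (h := h) hr hx d j
    field_simp
    linear_combination (1 + x) * this

end

/-! ### The change of sign at a fixed negative argument -/

section

variable {h : ℝ[X]} {r : ℕ} {x : ℝ}

theorem sectionSeq_zero_of_lt {j : ℤ} (h1 : -(r : ℤ) < j) (h2 : j + h.natDegree < r) :
    sectionSeq h r x 0 j =
      ∑ k ∈ Finset.range (h.natDegree + 1), if j + k = 0 then h.coeff k else 0 := by
  refine Finset.sum_congr rfl fun k hk => ?_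
  have hk' : k ≤ h.natDegree := by simpa [Nat.lt_succ_iff] using hk
  by_cases h0 : j + k = 0
  · simp [h0]
  · rw [if_neg h0, if_neg]
    intro hd
    exact h0 (Int.eq_zero_of_abs_lt_dvd hd (by rw [abs_lt]; omega))

theorem sectionSeq_zero_nonneg (hnn : NonnegCoeffs h) {j : ℤ} (h1 : -(r : ℤ) < j)
    (h2 : j + h.natDegree < r) : 0 ≤ sectionSeq h r x 0 j := by
  rw [sectionSeq_zero_of_lt h1 h2]
  refine Finset.sum_nonneg fun k _ => ?_
  split_ifs
  exacts [hnn k, le_rfl]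

theorem sectionSeq_zero_zero (hr : r ≠ 0) (hdeg : h.natDegree = r)
    (hpal : ∀ k ≤ h.natDegree, h.coeff (h.natDegree - k) = h.coeff k) :
    sectionSeq h r x 0 0 = h.coeff 0 * (1 + x) := by
  obtain ⟨n, rfl⟩ := Nat.exists_eq_succ_of_ne_zero hr
  have h1 : h.coeff (n + 1) = h.coeff 0 := by simpa [hdeg] using hpal 0 (Nat.zero_le _)
  have h0 : ((n.succ : ℕ) : ℤ) ≠ 0 := by positivity
  simp only [sectionSeq]
  rw [hdeg, Finset.sum_range_succ, Finset.sum_range_succ', Finset.sum_eq_zero]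
  · simp only [zero_add, Nat.cast_zero, dvd_zero, if_true, Int.zero_ediv, zpow_zero, dvd_refl,
      Int.ediv_self h0, zpow_one]
    rw [h1]
    ring
  · intro k hk
    have hk' : k < n := by simpa using hk
    rw [if_neg]
    intro hd
    have := Int.eq_zero_of_abs_lt_dvd hd (by rw [abs_lt]; push_cast; omega)
    push_cast at this
    omega

/-- A sum over a full period of the powers of `x` that occur in `sectionSeq`. -/
theorem sum_zpow_period (hr : r ≠ 0) {n : ℤ} (h1 : -(r : ℤ) < n) (h2 : n ≤ r) :
    ∑ m ∈ Finset.range r, (if (r : ℤ) ∣ n + m then x ^ ((n + m) / (r : ℤ)) else 0) =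
      if n ≤ 0 then 1 else x := by
  have h0 : (r : ℤ) ≠ 0 := by exact_mod_cast hr
  split_ifs with hn
  · rw [Finset.sum_eq_single (-n).toNat]
    · have : n + ((-n).toNat : ℤ) = 0 := by omega
      rw [this, if_pos (dvd_zero _), Int.zero_ediv, zpow_zero]
    · intro m hm hne
      have hm' : m < r := by simpa using hm
      rw [if_neg]
      intro hd
      have := Int.eq_zero_of_abs_lt_dvd hd (by rw [abs_lt]; omega)
      omega
    · intro hm
      exact absurd (Finset.mem_range.2 (by omega)) hm
  · rw [Finset.sum_eq_single (r - n).toNat]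
    · have : n + ((r - n).toNat : ℤ) = r := by omega
      rw [this, if_pos dvd_rfl, Int.ediv_self h0, zpow_one]
    · intro m hm hne
      have hm' : m < r := by simpa using hm
      rw [if_neg]
      intro hd
      have := Int.eq_zero_of_abs_lt_dvd (dvd_sub_self_right.2 hd) (by rw [abs_lt]; omega)
      omega
    · intro hm
      exact absurd (Finset.mem_range.2 (by omega)) hm

theorem sectionSeq_one (hr : r ≠ 0) {j : ℤ} (h1 : -(r : ℤ) < j) (h2 : j + h.natDegree ≤ r) :
    sectionSeq h r x 1 j =
      ∑ k ∈ Finset.range (h.natDegree + 1), h.coeff k * if j + k ≤ 0 then 1 else x := by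
  simp only [sectionSeq]
  rw [Finset.sum_comm]
  refine Finset.sum_congr rfl fun k hk => ?_
  have hk' : k ≤ h.natDegree := by simpa [Nat.lt_succ_iff] using hk
  rw [← sum_zpow_period hr (by omega) (by omega), Finset.mul_sum]
  refine Finset.sum_congr rfl fun m _ => ?_
  rw [add_right_comm, mul_ite, mul_zero]

theorem sectionSeq_one_reflect (hr : r ≠ 0)
    (hpal : ∀ k ≤ h.natDegree, h.coeff (h.natDegree - k) = h.coeff k) {j : ℤ}
    (h1 : -(r : ℤ) < j) (h2 : j + h.natDegree ≤ r) :
    sectionSeq h r x 1 (1 - h.natDegree - j) =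
      ∑ k ∈ Finset.range (h.natDegree + 1), h.coeff k * if j + k ≤ 0 then x else 1 := by
  rw [sectionSeq_one hr (by omega) (by omega), ← Finset.sum_range_reflect]
  refine Finset.sum_congr rfl fun k hk => ?_
  have hk' : k ≤ h.natDegree := by simpa [Nat.lt_succ_iff] using hk
  have h3 : h.natDegree + 1 - 1 - k = h.natDegree - k := by omega
  rw [h3, hpal k hk']
  by_cases h4 : j + k ≤ 0
  · rw [if_pos h4, if_neg (by omega)]
  · rw [if_neg h4, if_pos (by omega)]

theorem evenSeq_one (hr : r ≠ 0)
    (hpal : ∀ k ≤ h.natDegree, h.coeff (h.natDegree - k) = h.coeff k) {j : ℤ}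
    (h1 : -(r : ℤ) < j) (h2 : j + h.natDegree ≤ r) :
    evenSeq h r x 1 j =
      (1 + x) * ∑ k ∈ Finset.range (h.natDegree + 1), h.coeff k := by
  rw [evenSeq, sectionSeq_one hr h1 h2, Nat.cast_one, sectionSeq_one_reflect hr hpal h1 h2,
    ← Finset.sum_add_distrib, Finset.mul_sum]
  refine Finset.sum_congr rfl fun k _ => ?_
  split_ifs <;> ring

theorem mul_oddSeq_one (hr : r ≠ 0) (hx : x ≠ 0)
    (hpal : ∀ k ≤ h.natDegree, h.coeff (h.natDegree - k) = h.coeff k) {j : ℤ}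
    (h1 : -(r : ℤ) < j) (h2 : j + h.natDegree ≤ r) :
    x * oddSeq h r x 1 j = ∑ k ∈ Finset.range (h.natDegree + 1),
      h.coeff k * if j + k ≤ 0 then 1 + x ^ 2 else 2 * x := by
  rw [oddSeq, mul_add, sectionSeq_sub_period hr hx, sectionSeq_one hr h1 h2, Nat.cast_one,
    sectionSeq_one_reflect hr hpal h1 h2, Finset.mul_sum, ← Finset.sum_add_distrib]
  refine Finset.sum_congr rfl fun k _ => ?_
  split_ifs <;> ring

theorem oddSeq_one_mono (hr : r ≠ 0) (hx : x < 0) (hnn : NonnegCoeffs h)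
    (hpal : ∀ k ≤ h.natDegree, h.coeff (h.natDegree - k) = h.coeff k) {i j : ℤ}
    (h1 : -(r : ℤ) < i) (hij : i ≤ j) (h2 : j + h.natDegree ≤ r) :
    oddSeq h r x 1 i ≤ oddSeq h r x 1 j := by
  have h3 : x * oddSeq h r x 1 j ≤ x * oddSeq h r x 1 i := by
    rw [mul_oddSeq_one hr hx.ne hpal h1 (by omega), mul_oddSeq_one hr hx.ne hpal (by omega) h2]
    refine Finset.sum_le_sum fun k _ => mul_le_mul_of_nonneg_left ?_ (hnn k)
    split_ifs
    · exact le_rfl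
    · omega
    · nlinarith
    · exact le_rfl
  exact le_of_mul_le_mul_left (by linarith : (-x) * oddSeq h r x 1 i ≤ (-x) * oddSeq h r x 1 j)
    (by linarith)

/-- On the half period of level `0`, `oddSeq` is determined by `sectionSeq`. -/
theorem mul_oddSeq_zero (hr : r ≠ 0) (hx : x ≠ 0)
    (hpal : ∀ k ≤ h.natDegree, h.coeff (h.natDegree - k) = h.coeff k) {j : ℤ}
    (h1 : -(r : ℤ) < j) (h2 : j + h.natDegree < r) :
    x * oddSeq h r x 0 j = (1 + x) * sectionSeq h r x 0 j := by
  have h3 := sectionSeq_inv hr hx hpal 0 j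
  rw [sectionSeq_zero_of_lt h1 h2, ← sectionSeq_zero_of_lt (x := x) h1 h2] at h3
  rw [oddSeq, mul_add, sectionSeq_sub_period hr hx, ← h3]
  ring

theorem halfPeriod_zero_cases (hs : h.natDegree ≤ r) {j : ℤ}
    (hj : HalfPeriod ((0 : ℕ) - h.natDegree) r j) :
    (-(r : ℤ) < j ∧ j + h.natDegree < r) ∨ (h.natDegree = r ∧ j = 0) := by
  unfold HalfPeriod at hj
  push_cast at hj
  omega

theorem evenSeq_zero_nonneg (hnn : NonnegCoeffs h) {j : ℤ}
    (h1 : -(r : ℤ) < j) (h2 : j + h.natDegree < r) : 0 ≤ evenSeq h r x 0 j :=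
  add_nonneg (sectionSeq_zero_nonneg hnn h1 h2)
    (sectionSeq_zero_nonneg hnn (by push_cast; omega) (by push_cast; omega))

theorem mul_oddSeq_zero_zero (hr : r ≠ 0) (hx : x ≠ 0) (hs : h.natDegree = r)
    (hpal : ∀ k ≤ h.natDegree, h.coeff (h.natDegree - k) = h.coeff k) :
    x * oddSeq h r x 0 0 = (1 + x) * (2 * h.coeff 0) := by
  have h1 := sectionSeq_sub_period (h := h) hr hx 0 0
  rw [sectionSeq_zero_zero hr hs hpal] at h1
  rw [oddSeq, hs, show ((0 : ℕ) : ℤ) - r - 0 = 0 - r by simp]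
  linear_combination 2 * h1

theorem oneSignChange_zero (hr : r ≠ 0) (hx : x < 0) (hnn : NonnegCoeffs h)
    (hpal : ∀ k ≤ h.natDegree, h.coeff (h.natDegree - k) = h.coeff k) (hs : h.natDegree ≤ r) :
    OneSignChange ((0 : ℕ) - h.natDegree) r (evenSeq h r x 0)
      (fun j => (1 + x) * oddSeq h r x 0 j) := by
  refine ⟨-1, Or.inr rfl, Or.inl ⟨fun j hj => ?_, fun i j hi hj hij hc => ?_⟩⟩
  · have key : ∀ c, 0 ≤ c → x * oddSeq h r x 0 j = (1 + x) * c →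
        0 ≤ -1 * ((1 + x) * oddSeq h r x 0 j) := by
      intro c hc h1
      have h2 : 0 ≤ (1 + x) ^ 2 * c := by positivity
      have h3 : x * ((1 + x) * oddSeq h r x 0 j) = (1 + x) ^ 2 * c := by
        linear_combination (1 + x) * h1
      by_contra hcon
      nlinarith
    rcases halfPeriod_zero_cases hs hj with ⟨h1, h2⟩ | ⟨h1, rfl⟩
    · exact key _ (sectionSeq_zero_nonneg hnn h1 h2) (mul_oddSeq_zero hr hx.ne hpal h1 h2)
    · exact key _ (by linarith [hnn 0]) (mul_oddSeq_zero_zero hr hx.ne h1 hpal)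
  · rcases halfPeriod_zero_cases hs hi with ⟨h1, h2⟩ | ⟨h1, rfl⟩
    · linarith [evenSeq_zero_nonneg (x := x) hnn h1 h2, hc.1]
    · unfold HalfPeriod at hj
      push_cast at hj
      omega

theorem halfPeriod_one (hs : h.natDegree ≤ r) {j : ℤ}
    (hj : HalfPeriod ((1 : ℕ) - h.natDegree) r j) : -(r : ℤ) < j ∧ j + h.natDegree ≤ r := by
  unfold HalfPeriod at hj
  push_cast at hj
  omega

theorem oneSignChange_one (hr : r ≠ 0) (hx : x < 0) (hnn : NonnegCoeffs h)
    (hpal : ∀ k ≤ h.natDegree, h.coeff (h.natDegree - k) = h.coeff k) (hs : h.natDegree ≤ r) :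
    OneSignChange ((1 : ℕ) - h.natDegree) r (evenSeq h r x 1)
      (fun j => (1 + x) * oddSeq h r x 1 j) := by
  have hT : 0 ≤ ∑ k ∈ Finset.range (h.natDegree + 1), h.coeff k :=
    Finset.sum_nonneg fun k _ => hnn k
  have hmono : ∀ i j, HalfPeriod ((1 : ℕ) - h.natDegree) r i →
      HalfPeriod ((1 : ℕ) - h.natDegree) r j → i < j → oddSeq h r x 1 i ≤ oddSeq h r x 1 j :=
    fun i j hi hj hij => oddSeq_one_mono hr hx hnn hpal (halfPeriod_one hs hi).1 hij.le
      (halfPeriod_one hs hj).2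
  rcases le_total 0 (1 + x) with h0 | h0
  · refine ⟨1, Or.inl rfl, Or.inr ⟨fun j hj => ?_, fun i j hi hj hij hc => ?_⟩⟩
    · obtain ⟨h1, h2⟩ := halfPeriod_one hs hj
      rw [evenSeq_one hr hpal h1 h2, one_mul]
      exact mul_nonneg h0 hT
    · have := mul_le_mul_of_nonneg_left (hmono i j hi hj hij) h0
      simp only [one_mul] at hc
      linarith [hc.1, hc.2]
  · refine ⟨-1, Or.inr rfl, Or.inr ⟨fun j hj => ?_, fun i j hi hj hij hc => ?_⟩⟩
    · obtain ⟨h1, h2⟩ := halfPeriod_one hs hj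
      rw [evenSeq_one hr hpal h1 h2]
      nlinarith
    · have := mul_le_mul_of_nonpos_left (hmono i j hi hj hij) h0
      simp only at hc
      linarith [hc.1, hc.2]

/-- At a fixed negative argument, `evenSeq` and `oddSeq` together change sign at most once. -/
theorem oneSignChange (hr : r ≠ 0) (hx : x < 0) (hnn : NonnegCoeffs h)
    (hpal : ∀ k ≤ h.natDegree, h.coeff (h.natDegree - k) = h.coeff k) (hs : h.natDegree ≤ r)
    (d : ℕ) : OneSignChange (d - h.natDegree) r (evenSeq h r x d)
      (fun j => (1 + x) * oddSeq h r x d j) := by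
  induction d using Nat.twoStepInduction with
  | zero => exact oneSignChange_zero hr hx hnn hpal hs
  | one => exact oneSignChange_one hr hx hnn hpal hs
  | more d ih _ =>
    have hN : ((d + 2 : ℕ) : ℤ) - h.natDegree = (d : ℤ) - h.natDegree + 2 := by push_cast; ring
    have hpair := foldedPair (h := h) hr hx.ne (d + 2)
    rw [hN] at hpair ⊢
    refine OneSignChange.shift (OneSignChange.of_second_difference (K := (x - 1) ^ 2)
      (by positivity) zero_le_one ?_ (by positivity) hpair.shift (fun j => evenSeq_symm d j)
      (fun j => by rw [oddSeq_symm]) (fun j => evenSeq_second_difference hr hx.ne d j)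
      (fun j => ?_) ih)
    · rw [← div_neg]
      exact div_nonneg (by positivity) (by linarith)
    · linear_combination (1 + x) * oddSeq_second_difference (h := h) hr hx.ne d j

/-- At the argument `-1`, each of `evenSeq` and `oddSeq` is of one sign. -/
theorem sameSign_neg_one (hr : r ≠ 0) (hnn : NonnegCoeffs h)
    (hpal : ∀ k ≤ h.natDegree, h.coeff (h.natDegree - k) = h.coeff k) (hs : h.natDegree ≤ r)
    (d : ℕ) :
    (∃ s : ℝ, (s = 1 ∨ s = -1) ∧
      ∀ j, HalfPeriod (d - h.natDegree) r j → 0 ≤ s * evenSeq h r (-1) d j) ∧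
    (∃ s : ℝ, (s = 1 ∨ s = -1) ∧
      ∀ j, HalfPeriod (d - h.natDegree) r j → 0 ≤ s * oddSeq h r (-1) d j) := by
  have hx : (-1 : ℝ) ≠ 0 := by norm_num
  have he : ∀ d j, evenSeq h r (-1) d j + evenSeq h r (-1) d (d - h.natDegree + r - j) = 0 := by
    intro d j
    rw [evenSeq_add hr hx]
    norm_num
  have ho : ∀ d j, oddSeq h r (-1) d j + oddSeq h r (-1) d (d - h.natDegree - j) = 0 := by
    intro d j
    have := oddSeq_add (h := h) hr hx d j
    linarith
  induction d using Nat.twoStepInduction with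
  | zero =>
    refine ⟨⟨1, Or.inl rfl, fun j hj => ?_⟩, ⟨1, Or.inl rfl, fun j hj => ?_⟩⟩
    · rw [one_mul]
      rcases halfPeriod_zero_cases hs hj with ⟨h1, h2⟩ | ⟨h1, rfl⟩
      · exact evenSeq_zero_nonneg hnn h1 h2
      · have := he 0 0
        rw [h1] at this
        simp only [Nat.cast_zero, zero_sub, neg_add_cancel, sub_zero] at this
        linarith
    · rw [one_mul]
      rcases halfPeriod_zero_cases hs hj with ⟨h1, h2⟩ | ⟨h1, rfl⟩
      · linarith [mul_oddSeq_zero hr hx hpal h1 h2]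
      · linarith [mul_oddSeq_zero_zero hr hx h1 hpal]
  | one =>
    refine ⟨⟨1, Or.inl rfl, fun j hj => ?_⟩, ⟨1, Or.inl rfl, fun j hj => ?_⟩⟩
    · obtain ⟨h1, h2⟩ := halfPeriod_one hs hj
      rw [evenSeq_one hr hpal h1 h2]
      norm_num
    · obtain ⟨h1, h2⟩ := halfPeriod_one hs hj
      have h3 := mul_oddSeq_one hr hx hpal h1 h2
      have h4 := mul_oddSeq_one hr hx hpal h1 h2
      rw [← Finset.sum_range_reflect] at h4
      have h5 : -1 * oddSeq h r (-1) 1 j + -1 * oddSeq h r (-1) 1 j ≤ 0 := by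
        nth_rewrite 1 [h3]
        rw [h4, ← Finset.sum_add_distrib]
        refine Finset.sum_nonpos fun k hk => ?_
        have hk' : k ≤ h.natDegree := by simpa [Nat.lt_succ_iff] using hk
        have h6 : h.natDegree + 1 - 1 - k = h.natDegree - k := by omega
        have h7 := hnn k
        unfold HalfPeriod at hj
        push_cast at hj
        rw [h6, hpal k hk']
        split_ifs
        · omega
        · linarith
        · linarith
        · linarith
      linarith
  | more d ih _ =>
    have hN : ((d + 2 : ℕ) : ℤ) - h.natDegree = (d : ℤ) - h.natDegree + 2 := by push_cast; ring
    have hD : ∀ j, HalfPeriod ((d + 2 : ℕ) - h.natDegree) r j →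
        HalfPeriod (d - h.natDegree) r (j - 1) := by
      intro j hj; unfold HalfPeriod at *; omega
    obtain ⟨⟨s, hs, h1⟩, ⟨t, ht, h2⟩⟩ := ih
    refine ⟨⟨-s, by rcases hs with rfl | rfl <;> simp, fun j hj => ?_⟩,
      ⟨-t, by rcases ht with rfl | rfl <;> simp, fun j hj => ?_⟩⟩
    · have := nonpos_of_symm_antisymm (N := d - h.natDegree) (r := r) (K := 4)
        (a := fun j => s * evenSeq h r (-1) (d + 2) (j + 1))
        (e := fun j => s * evenSeq h r (-1) d j) (by norm_num) (fun j => ?_) (fun j => ?_)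
        (fun j => by rw [evenSeq_symm]) (fun j => ?_) h1 (j - 1) (hD j hj)
      · simp only [sub_add_cancel] at this
        linarith
      · rw [← evenSeq_symm (d + 2), hN]
        congr 2
        ring
      · have h3 := he (d + 2) (j + 1)
        rw [hN, show (d : ℤ) - h.natDegree + 2 + r - (j + 1) = d - h.natDegree + r - j + 1 by
          ring] at h3
        linear_combination s * h3
      · linear_combination s * evenSeq_second_difference (h := h) hr hx d j
    · have := nonpos_of_symm_antisymm (N := -(d - h.natDegree + r)) (r := r) (K := 4)
        (a := fun j => t * oddSeq h r (-1) (d + 2) (-j + 1))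
        (e := fun j => t * oddSeq h r (-1) d (-j)) (by norm_num) (fun j => ?_) (fun j => ?_)
        (fun j => ?_) (fun j => ?_)
        (fun j hj => h2 (-j) (by unfold HalfPeriod at *; omega)) (-(j - 1))
        (by have := hD j hj; unfold HalfPeriod at *; omega)
      · simp only [neg_neg, sub_add_cancel] at this
        linarith
      · rw [← oddSeq_symm (d + 2), hN]
        congr 2
        ring
      · have h3 := ho (d + 2) (-j + 1)
        rw [hN, show (d : ℤ) - h.natDegree + 2 - (-j + 1) =
          -(-(d - h.natDegree + r) + r - j) + 1 by ring] at h3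
        linear_combination t * h3
      · rw [← oddSeq_symm d]
        congr 2
        ring
      · have h3 := oddSeq_second_difference (h := h) hr hx d (-j)
        rw [show -(j + 1) + 1 = -j - 1 + 1 by ring, show -(j - 1) + 1 = -j + 1 + 1 by ring]
        linear_combination t * h3

end

/-! ### Real-rooted polynomials and interlacing -/

theorem prod_sub_sign {n i : ℕ} {ρ : ℕ → ℝ} {x : ℝ} (hi : i ≤ n) (h1 : ∀ k < i, x < ρ k)
    (h2 : ∀ k, i ≤ k → k < n → ρ k < x) :
    0 < (-1) ^ i * ∏ k ∈ Finset.range n, (x - ρ k) := by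
  rw [← Finset.prod_range_mul_prod_Ico _ hi, ← mul_assoc]
  have h3 : (-1 : ℝ) ^ i * ∏ k ∈ Finset.range i, (x - ρ k) =
      ∏ k ∈ Finset.range i, (ρ k - x) := by
    calc _ = ∏ k ∈ Finset.range i, (-1) * (x - ρ k) := by
          rw [Finset.prod_mul_distrib, Finset.prod_const, Finset.card_range]
      _ = _ := Finset.prod_congr rfl fun k _ => by ring
  rw [h3]
  refine mul_pos (Finset.prod_pos fun k hk => ?_) (Finset.prod_pos fun k hk => ?_)
  · linarith [h1 k (by simpa using hk)]
  · rw [Finset.mem_Ico] at hk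
    linarith [h2 k hk.1 hk.2]

theorem lt_of_succ_lt {n : ℕ} {ρ : ℕ → ℝ} (h : ∀ i, i + 1 < n → ρ (i + 1) < ρ i) {i j : ℕ}
    (hij : i < j) (hj : j < n) : ρ j < ρ i := by
  induction j, hij using Nat.le_induction with
  | base => exact h i hj
  | succ k hk ih => exact (h k hj).trans (ih (by omega))

theorem exists_between_of_sign_change (g : ℝ[X]) {u v : ℝ} (huv : u < v)
    (hg : g.eval u * g.eval v < 0) : ∃ z, u < z ∧ z < v ∧ g.eval z = 0 := by
  have hc : ContinuousOn (fun x => g.eval x) (Set.Icc u v) := g.continuous.continuousOn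
  rcases lt_trichotomy (g.eval u) 0 with h | h | h
  · have h' : 0 < g.eval v := by by_contra hcon; nlinarith
    obtain ⟨z, hz, hz0⟩ := intermediate_value_Ioo huv.le hc ⟨h, h'⟩
    exact ⟨z, hz.1, hz.2, hz0⟩
  · simp [h] at hg
  · have h' : g.eval v < 0 := by by_contra hcon; nlinarith
    obtain ⟨z, hz, hz0⟩ := intermediate_value_Ioo' huv.le hc ⟨h', h⟩
    exact ⟨z, hz.1, hz.2, hz0⟩

/-- A polynomial of degree at most `n` with `n` changes of sign splits, with one root in each of the
corresponding intervals. -/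
theorem exists_roots_of_sign_changes {g : ℝ[X]} {n : ℕ} {y : ℕ → ℝ}
    (hy : ∀ i < n, y (i + 1) < y i) (hsign : ∀ i ≤ n, 0 < (-1) ^ i * g.eval (y i))
    (hdeg : g.natDegree ≤ n) :
    ∃ ρ : ℕ → ℝ, (∀ i < n, y (i + 1) < ρ i ∧ ρ i < y i) ∧ g.natDegree = n ∧
      g = C g.leadingCoeff * ∏ i ∈ Finset.range n, (X - C (ρ i)) := by
  have hex : ∀ i, ∃ z, i < n → y (i + 1) < z ∧ z < y i ∧ g.eval z = 0 := by
    intro i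
    by_cases hi : i < n
    · obtain ⟨z, hz⟩ := exists_between_of_sign_change g (hy i hi) (by
        have h1 := hsign i hi.le
        have h2 := hsign (i + 1) hi
        have h3 : ((-1 : ℝ) ^ i) ^ 2 = 1 := by rw [← pow_mul, mul_comm, pow_mul]; norm_num
        have h4 := mul_pos h1 h2
        rw [pow_succ] at h4
        nlinarith)
      exact ⟨z, fun _ => hz⟩
    · exact ⟨0, fun h => absurd h hi⟩
  choose ρ hρ using hex
  have hg0 : g ≠ 0 := by
    rintro rfl
    simpa using hsign 0 (Nat.zero_le _)
  have hanti : ∀ i, i + 1 < n → ρ (i + 1) < ρ i := fun i hi =>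
    (hρ (i + 1) hi).2.1.trans (hρ i (by omega)).1
  have hnodup : ((Multiset.range n).map ρ).Nodup := by
    refine Multiset.Nodup.map_on (fun i hi j hj hij => ?_) (Multiset.nodup_range n)
    rw [Multiset.mem_range] at hi hj
    rcases lt_trichotomy i j with h | h | h
    · exact absurd hij (lt_of_succ_lt hanti h hj).ne'
    · exact h
    · exact absurd hij (lt_of_succ_lt hanti h hi).ne
  have hle : (Multiset.range n).map ρ ≤ g.roots := by
    rw [Multiset.le_iff_subset hnodup]
    intro z hz
    rw [Multiset.mem_map] at hz
    obtain ⟨i, hi, rfl⟩ := hz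
    rw [mem_roots hg0]
    exact (hρ i (Multiset.mem_range.1 hi)).2.2
  have hcard : g.roots.card ≤ ((Multiset.range n).map ρ).card := by
    simpa using (card_roots' g).trans hdeg
  have hroots := Multiset.eq_of_le_of_card_le hle hcard
  have hn : g.roots.card = n := by simp [← hroots]
  have hnat : g.natDegree = n := le_antisymm hdeg (hn ▸ card_roots' g)
  refine ⟨ρ, fun i hi => ⟨(hρ i hi).1, (hρ i hi).2.1⟩, hnat, ?_⟩
  conv_lhs => rw [← C_leadingCoeff_mul_prod_multiset_X_sub_C (hn.trans hnat.symm), ← hroots,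
    Multiset.map_map]
  rfl

theorem exists_lt_sign_pos {g : ℝ[X]} (hlead : 0 < g.leadingCoeff) (b : ℝ) :
    ∃ y < b, 0 < (-1) ^ g.natDegree * g.eval y := by
  rcases Nat.eq_zero_or_pos g.natDegree with h0 | h0
  · refine ⟨b - 1, by linarith, ?_⟩
    rw [eq_C_of_natDegree_eq_zero h0] at hlead ⊢
    simpa using hlead
  · have hc : ((-X : ℝ[X])).natDegree = 1 := by simp
    set f : ℝ[X] := C ((-1) ^ g.natDegree) * g.comp (-X) with hf
    have hne : ((-1 : ℝ) ^ g.natDegree) ≠ 0 := pow_ne_zero _ (by norm_num)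
    have hdeg : f.natDegree = g.natDegree := by
      rw [hf, natDegree_C_mul hne, natDegree_comp, hc, mul_one]
    have hl : f.leadingCoeff = g.leadingCoeff := by
      rw [hf, leadingCoeff_mul, leadingCoeff_C, leadingCoeff_comp (by rw [hc]; norm_num)]
      simp only [leadingCoeff_neg, leadingCoeff_X]
      rw [mul_left_comm, ← mul_pow]
      norm_num
    have ht := f.tendsto_atTop_of_leadingCoeff_nonneg
      (natDegree_pos_iff_degree_pos.1 (by omega)) (by linarith)
    obtain ⟨z, hz, hzb⟩ := ((ht.eventually_gt_atTop 0).and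
      (Filter.eventually_gt_atTop (-b))).exists
    refine ⟨-z, by linarith, ?_⟩
    simpa [hf] using hz

/-! ### Symmetric polynomials -/

theorem IsSymmetricPoly.mul_reverse {m : ℕ} {p : ℝ[X]} (hp : IsSymmetricPoly m p) :
    X ^ p.natDegree * p = X ^ m * p.reverse := by
  refine eq_of_infinite_eval_eq _ _ ((Set.finite_singleton (0 : ℝ)).infinite_compl.mono ?_)
  intro x hx
  have hx0 : x ≠ 0 := hx
  have h1 := hp x hx0
  let _ : Invertible x⁻¹ := invertibleOfNonzero (inv_ne_zero hx0)
  have h2 := eval₂_reverse_mul_pow (RingHom.id ℝ) x⁻¹ p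
  simp only [eval₂_id, invOf_eq_inv, inv_inv] at h2
  simp only [Set.mem_ofPred_eq, eval_mul, eval_pow, eval_X]
  rw [h1, ← h2, zpow_natCast, inv_pow]
  field_simp

theorem IsSymmetricPoly.natDegree_le {m : ℕ} {p : ℝ[X]} (hp : IsSymmetricPoly m p) :
    p.natDegree ≤ m := by
  by_contra hcon
  rw [not_le] at hcon
  have h1 := congrArg (fun q => q.coeff m) hp.mul_reverse
  simp only [coeff_X_pow_mul'] at h1
  rw [if_neg (by omega), if_pos le_rfl, Nat.sub_self, coeff_zero_reverse] at h1
  have h2 : p = 0 := leadingCoeff_eq_zero.1 h1.symm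
  simp [h2] at hcon

theorem IsSymmetricPoly.coeff_sub {m : ℕ} {p : ℝ[X]} (hp : IsSymmetricPoly m p) {k : ℕ}
    (hk : k ≤ m) : p.coeff (m - k) = p.coeff k := by
  have hn := hp.natDegree_le
  have h1 := congrArg (fun q => q.coeff (p.natDegree + k)) hp.mul_reverse
  simp only [coeff_X_pow_mul'] at h1
  rw [if_pos (by omega), Nat.add_sub_cancel_left] at h1
  rw [h1]
  split_ifs with h2
  · rw [coeff_reverse, revAt_le (by omega)]
    congr 1
    omega
  · exact coeff_eq_zero_of_natDegree_lt (by omega)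

theorem IsSymmetricPoly.natDegree_eq {m : ℕ} {p : ℝ[X]} (hp : IsSymmetricPoly m p)
    (h0 : p.coeff 0 ≠ 0) : p.natDegree = m := by
  refine le_antisymm hp.natDegree_le (le_natDegree_of_ne_zero ?_)
  have := hp.coeff_sub (Nat.zero_le m)
  rw [Nat.sub_zero] at this
  rwa [this]

theorem IsSymmetricPoly.leadingCoeff_eq {m : ℕ} {p : ℝ[X]} (hp : IsSymmetricPoly m p)
    (h0 : p.coeff 0 ≠ 0) : p.leadingCoeff = p.coeff 0 := by
  rw [leadingCoeff, hp.natDegree_eq h0, ← hp.coeff_sub (Nat.zero_le m), Nat.sub_zero]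

/-! ### Interlacing of factored polynomials -/

theorem roots_C_mul_prod {n : ℕ} {ρ : ℕ → ℝ} {c : ℝ} (hc : c ≠ 0) :
    (C c * ∏ i ∈ Finset.range n, (X - C (ρ i))).roots = (Multiset.range n).map ρ := by
  rw [roots_C_mul _ hc]
  have := roots_multiset_prod_X_sub_C ((Multiset.range n).map ρ)
  rw [Multiset.map_map] at this
  exact this

theorem splits_C_mul_prod {n : ℕ} {ρ : ℕ → ℝ} {c : ℝ} :
    (C c * ∏ i ∈ Finset.range n, (X - C (ρ i))).Splits :=
  (Splits.C c).mul (Splits.prod fun _ _ => Splits.X_sub_C _)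

theorem rootsDesc_C_mul_prod {n : ℕ} {ρ : ℕ → ℝ} {c : ℝ} (hc : c ≠ 0)
    (hρ : ∀ i j, i < j → j < n → ρ j ≤ ρ i) :
    rootsDesc (C c * ∏ i ∈ Finset.range n, (X - C (ρ i))) = (List.range n).map ρ := by
  rw [rootsDesc, roots_C_mul_prod hc]
  refine List.Perm.eq_of_pairwise' (r := (· ≥ ·)) (Multiset.pairwise_sort _ _) ?_ ?_
  · rw [List.pairwise_map]
    refine List.Pairwise.imp_of_mem ?_ (List.pairwise_lt_range (n := n))
    intro a b _ hb hab
    exact hρ a b hab (List.mem_range.1 hb)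
  · rw [← Multiset.coe_eq_coe, Multiset.sort_eq]
    rfl

theorem le_of_forall_succ_le {n : ℕ} {ρ : ℕ → ℝ} (h : ∀ i, i + 1 < n → ρ (i + 1) ≤ ρ i) (i j : ℕ)
    (hij : i < j) (hj : j < n) : ρ j ≤ ρ i := by
  induction j, hij using Nat.le_induction with
  | base => exact h i hj
  | succ k hk ih => exact (h k hj).trans (ih (by omega))

theorem interlaces_C_mul_prod {n : ℕ} {ρ σ : ℕ → ℝ} {c c' : ℝ} (hc : c ≠ 0) (hc' : c' ≠ 0)
    (h1 : ∀ i < n, σ i ≤ ρ i) (h2 : ∀ i < n, ρ (i + 1) ≤ σ i) :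
    Interlaces (C c' * ∏ i ∈ Finset.range n, (X - C (σ i)))
      (C c * ∏ i ∈ Finset.range (n + 1), (X - C (ρ i))) := by
  have hρ := le_of_forall_succ_le (n := n + 1) (ρ := ρ) fun i hi =>
    (h2 i (by omega)).trans (h1 i (by omega))
  have hσ := le_of_forall_succ_le (n := n) (ρ := σ) fun i hi =>
    (h1 (i + 1) (by omega)).trans (h2 i (by omega))
  refine ⟨splits_C_mul_prod, splits_C_mul_prod, Or.inr (Or.inr ?_)⟩
  rw [rootsDesc_C_mul_prod hc hρ, rootsDesc_C_mul_prod hc' hσ]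
  simp only [List.length_map, List.length_range, List.getElem_map, List.getElem_range]
  exact ⟨Or.inr trivial, fun i hf _ => h1 i hf, fun i hf _ => h2 i hf⟩

/-! ### The sections as polynomials -/

section

namespace NonnegCoeffs

theorem sum {ι : Type*} {s : Finset ι} {f : ι → ℝ[X]} (hf : ∀ i ∈ s, NonnegCoeffs (f i)) :
    NonnegCoeffs (∑ i ∈ s, f i) :=
  fun n => by rw [finsetSum_coeff]; exact Finset.sum_nonneg fun i hi => hf i hi n

theorem mul {p q : ℝ[X]} (hp : NonnegCoeffs p) (hq : NonnegCoeffs q) : NonnegCoeffs (p * q) :=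
  fun i => by
    rw [coeff_mul]
    exact Finset.sum_nonneg fun a _ => mul_nonneg (hp a.1) (hq a.2)

theorem coeff_mul_coeff_le {p q : ℝ[X]} (hp : NonnegCoeffs p) (hq : NonnegCoeffs q) (m n : ℕ) :
    p.coeff m * q.coeff n ≤ (p * q).coeff (m + n) := by
  rw [coeff_mul]
  exact Finset.single_le_sum (f := fun a : ℕ × ℕ => p.coeff a.1 * q.coeff a.2)
    (fun a _ => mul_nonneg (hp a.1) (hq a.2)) (a := (m, n)) (by simp)

theorem X_pow (n : ℕ) : NonnegCoeffs (X ^ n : ℝ[X]) := fun i => by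
  rw [coeff_X_pow]
  split_ifs <;> norm_num

theorem pow {p : ℝ[X]} (hp : NonnegCoeffs p) (n : ℕ) : NonnegCoeffs (p ^ n) := by
  induction n with
  | zero => simpa using X_pow 0
  | succ n ih => rw [pow_succ]; exact ih.mul hp

theorem divX {p : ℝ[X]} (hp : NonnegCoeffs p) : NonnegCoeffs p.divX := fun i => by
  rw [coeff_divX]
  exact hp _

end NonnegCoeffs

/-- `1 + X + ⋯ + X ^ (r - 1)`. -/
noncomputable def geomPoly (r : ℕ) : ℝ[X] := ∑ i ∈ Finset.range r, X ^ i

theorem coeff_geomPoly {r m : ℕ} (hm : m < r) : (geomPoly r).coeff m = 1 := by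
  simp only [geomPoly, finsetSum_coeff, coeff_X_pow]
  rw [Finset.sum_ite_eq, if_pos (Finset.mem_range.2 hm)]

theorem nonnegCoeffs_geomPoly (r : ℕ) : NonnegCoeffs (geomPoly r) :=
  NonnegCoeffs.sum fun i _ => NonnegCoeffs.X_pow i

theorem coeff_geomPoly_pow_pos {r : ℕ} (hr : r ≠ 0) {d m : ℕ} (hm : m < r) :
    0 < (geomPoly r ^ (d + 1)).coeff m := by
  have h0 : (geomPoly r ^ d).coeff 0 = 1 := by
    rw [coeff_zero_eq_eval_zero, eval_pow, ← coeff_zero_eq_eval_zero,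
      coeff_geomPoly (Nat.pos_of_ne_zero hr), one_pow]
  have := ((nonnegCoeffs_geomPoly r).pow d).coeff_mul_coeff_le (nonnegCoeffs_geomPoly r) 0 m
  rw [h0, coeff_geomPoly hm, zero_add, ← pow_succ] at this
  linarith

theorem contract_finsetSum {ι : Type*} {r : ℕ} (hr : r ≠ 0) (s : Finset ι) (f : ι → ℝ[X]) :
    contract r (∑ i ∈ s, f i) = ∑ i ∈ s, contract r (f i) := by
  ext n
  simp only [coeff_contract hr, finsetSum_coeff]

theorem eval_contract_C_mul_X_pow {r : ℕ} (hr : r ≠ 0) (c x : ℝ) (n : ℕ) :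
    (contract r (C c * X ^ n)).eval x = if r ∣ n then c * x ^ (n / r) else 0 := by
  split_ifs with hd
  · obtain ⟨m, rfl⟩ := hd
    have : contract r (C c * X ^ (r * m)) = C c * X ^ m := by
      ext n
      rw [coeff_contract hr, coeff_C_mul_X_pow, coeff_C_mul_X_pow]
      simp only [mul_comm n r, mul_right_inj' hr]
    rw [this, Nat.mul_div_cancel_left _ (Nat.pos_of_ne_zero hr)]
    simp
  · have : contract r (C c * X ^ n) = 0 := by
      ext m
      rw [coeff_contract hr, coeff_C_mul_X_pow, if_neg, coeff_zero]
      rintro rfl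
      exact hd (dvd_mul_left r m)
    rw [this, eval_zero]

/-- The polynomial whose `n`-th coefficient is the coefficient at `r * n` of
`X ^ k * h * (1 + ⋯ + X ^ (r - 1)) ^ d`. -/
noncomputable def sectionPoly (h : ℝ[X]) (r d k : ℕ) : ℝ[X] :=
  contract r (X ^ k * h * geomPoly r ^ d)

variable {h : ℝ[X]} {r : ℕ} {x : ℝ}

theorem sectionPoly_succ (hr : r ≠ 0) (d k : ℕ) :
    sectionPoly h r (d + 1) k = ∑ m ∈ Finset.range r, sectionPoly h r d (k + m) := by
  have h1 : X ^ k * h * geomPoly r ^ (d + 1) =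
      ∑ m ∈ Finset.range r, X ^ (k + m) * h * geomPoly r ^ d := by
    rw [pow_succ', ← mul_assoc]
    nth_rewrite 1 [geomPoly]
    rw [Finset.mul_sum, Finset.sum_mul]
    refine Finset.sum_congr rfl fun m _ => ?_
    rw [pow_add]
    ring
  rw [sectionPoly, h1, contract_finsetSum hr]
  rfl

theorem eval_sectionPoly (hr : r ≠ 0) (d k : ℕ) :
    (sectionPoly h r d k).eval x = sectionSeq h r x d k := by
  induction d generalizing k with
  | zero =>
    have h1 : X ^ k * h * geomPoly r ^ 0 =
        ∑ i ∈ Finset.range (h.natDegree + 1), C (h.coeff i) * X ^ (k + i) := by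
      conv_lhs => rw [h.as_sum_range_C_mul_X_pow, pow_zero, mul_one, Finset.mul_sum]
      refine Finset.sum_congr rfl fun i _ => ?_
      ring
    rw [sectionPoly, h1, contract_finsetSum hr, eval_finsetSum, sectionSeq]
    refine Finset.sum_congr rfl fun i _ => ?_
    rw [eval_contract_C_mul_X_pow hr]
    norm_cast
  | succ d ih =>
    rw [sectionPoly_succ hr, eval_finsetSum, sectionSeq]
    refine Finset.sum_congr rfl fun m _ => ?_
    rw [ih]
    push_cast
    rfl

theorem nonnegCoeffs_sectionPoly (hr : r ≠ 0) (hnn : NonnegCoeffs h) (d k : ℕ) :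
    NonnegCoeffs (sectionPoly h r d k) := fun i => by
  rw [sectionPoly, coeff_contract hr]
  exact (((NonnegCoeffs.X_pow k).mul hnn).mul ((nonnegCoeffs_geomPoly r).pow d)) _

theorem X_mul_divX_sectionPoly (hr : r ≠ 0) (d : ℕ) {k : ℕ} (hk : k ≠ 0) :
    X * (sectionPoly h r d k).divX = sectionPoly h r d k := by
  have h0 : (sectionPoly h r d k).coeff 0 = 0 := by
    rw [sectionPoly, coeff_contract hr, zero_mul, mul_assoc, coeff_X_pow_mul', if_neg (by omega)]
  conv_rhs => rw [← X_mul_divX_add (sectionPoly h r d k), h0, C_0, add_zero]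

theorem eval_divX_sectionPoly (hr : r ≠ 0) (hx : x ≠ 0) (d : ℕ) {k : ℕ} (hk : k ≠ 0) :
    (sectionPoly h r d k).divX.eval x = sectionSeq h r x d (k - r) := by
  have h1 := congrArg (eval x) (X_mul_divX_sectionPoly (h := h) hr d hk)
  rw [eval_mul, eval_X, eval_sectionPoly hr, ← sectionSeq_sub_period hr hx] at h1
  exact mul_left_cancel₀ hx h1

theorem coeff_zero_divX_sectionPoly_pos (hr : r ≠ 0) (hnn : NonnegCoeffs h) (h0 : 0 < h.coeff 0)
    (d : ℕ) {k : ℕ} (hk : k ≠ 0) (hkr : k ≤ r) : 0 < (sectionPoly h r (d + 1) k).divX.coeff 0 := by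
  rw [coeff_divX, sectionPoly, coeff_contract hr, zero_add, one_mul, mul_assoc, coeff_X_pow_mul',
    if_pos hkr]
  have h1 := hnn.coeff_mul_coeff_le ((nonnegCoeffs_geomPoly r).pow (d + 1)) 0 (r - k)
  rw [zero_add] at h1
  exact (mul_pos h0 (coeff_geomPoly_pow_pos hr (by omega))).trans_le h1

theorem veroneseU_eq_sectionPoly (hr : 1 ≤ r) (D : ℕ) :
    veroneseU r D h = sectionPoly h r D 0 := by
  refine (existsUnique_isVeroneseNumerator hr D h).unique (veroneseU_spec hr D h) ?_
  intro a ha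
  have hg : (geomPoly r : PowerSeries ℝ) * (1 - PowerSeries.X) = 1 - PowerSeries.X ^ r := by
    have h1 := congrArg (fun p : ℝ[X] => (p : PowerSeries ℝ)) (geom_sum_mul_neg (X : ℝ[X]) r)
    simpa [geomPoly] using h1
  have key : PowerSeries.mk a * (1 - (PowerSeries.X : PowerSeries ℝ) ^ r) ^ D =
      ((h * geomPoly r ^ D : ℝ[X]) : PowerSeries ℝ) := by
    rw [← hg, mul_pow, Polynomial.coe_mul, Polynomial.coe_pow, ← ha]
    ring
  have h2 := section_mul_one_sub_pow hr D (PowerSeries.mk a)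
  rw [key] at h2
  simp only [PowerSeries.coeff_mk] at h2
  rw [← h2]
  ext n
  rw [PowerSeries.coeff_mk, Polynomial.coeff_coe, Polynomial.coeff_coe, sectionPoly,
    coeff_contract (by omega), mul_comm r n, pow_zero, one_mul]

/-! ### The symmetric decomposition -/

/-- The symmetric part of degree `d` of the decomposition, for `e = d + 1 - deg h`. -/
noncomputable def decompLeft (h : ℝ[X]) (r d e : ℕ) : ℝ[X] :=
  ∑ k ∈ Finset.range e, sectionPoly h r d k

/-- The symmetric part of degree `d - 1` of the decomposition, for `e = d + 1 - deg h`. -/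
noncomputable def decompRight (h : ℝ[X]) (r d e : ℕ) : ℝ[X] :=
  ∑ k ∈ Finset.Ico e r, (sectionPoly h r d k).divX

variable {d e : ℕ}

theorem eval_decompLeft (hr : r ≠ 0) :
    (decompLeft h r d e).eval x = ∑ k ∈ Finset.range e, sectionSeq h r x d k := by
  simp only [decompLeft, eval_finsetSum, eval_sectionPoly hr]

theorem eval_decompRight (hr : r ≠ 0) (hx : x ≠ 0) (he : e ≠ 0) :
    (decompRight h r d e).eval x = ∑ k ∈ Finset.Ico e r, sectionSeq h r x d (k - r) := by
  rw [decompRight, eval_finsetSum]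
  refine Finset.sum_congr rfl fun k hk => ?_
  rw [Finset.mem_Ico] at hk
  exact eval_divX_sectionPoly hr hx d (by omega)

theorem sectionPoly_zero_eq (hr : r ≠ 0) (he : e ≠ 0) (her : e ≤ r) :
    sectionPoly h r (d + 1) 0 = decompLeft h r d e + X * decompRight h r d e := by
  rw [sectionPoly_succ hr, decompLeft, decompRight, Finset.mul_sum,
    ← Finset.sum_range_add_sum_Ico _ her]
  simp only [zero_add]
  congr 1
  refine Finset.sum_congr rfl fun k hk => ?_
  rw [Finset.mem_Ico] at hk
  exact (X_mul_divX_sectionPoly hr d (by omega)).symm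

theorem isSymmetricPoly_decompLeft (hr : r ≠ 0)
    (hpal : ∀ k ≤ h.natDegree, h.coeff (h.natDegree - k) = h.coeff k)
    (he : (e : ℤ) = d + 1 - h.natDegree) : IsSymmetricPoly d (decompLeft h r d e) := by
  intro x hx
  rw [eval_decompLeft hr, eval_decompLeft hr, zpow_natCast, Finset.mul_sum,
    ← Finset.sum_range_reflect]
  refine Finset.sum_congr rfl fun k hk => ?_
  rw [Finset.mem_range] at hk
  rw [sectionSeq_inv hr hx hpal]
  congr 1
  omega

theorem isSymmetricPoly_decompRight (hr : r ≠ 0)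
    (hpal : ∀ k ≤ h.natDegree, h.coeff (h.natDegree - k) = h.coeff k)
    (he : (e : ℤ) = d + 1 - h.natDegree) (he0 : e ≠ 0) :
    IsSymmetricPoly ((d : ℤ) - 1) (decompRight h r d e) := by
  intro x hx
  rw [eval_decompRight hr hx he0, eval_decompRight hr (inv_ne_zero hx) he0, zpow_sub_one₀ hx,
    zpow_natCast, mul_right_comm, ← div_eq_mul_inv, eq_div_iff hx, mul_comm, Finset.mul_sum,
    Finset.mul_sum]
  by_cases her : e ≤ r
  · refine Finset.sum_bij' (fun k _ => e + r - 1 - k) (fun k _ => e + r - 1 - k) ?_ ?_ ?_ ?_ ?_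
    · intro k hk; rw [Finset.mem_Ico] at *; omega
    · intro k hk; rw [Finset.mem_Ico] at *; omega
    · intro k hk; rw [Finset.mem_Ico] at *; omega
    · intro k hk; rw [Finset.mem_Ico] at *; omega
    · intro k hk
      rw [Finset.mem_Ico] at hk
      rw [sectionSeq_inv hr hx hpal, sectionSeq_sub_period hr hx]
      congr 1
      omega
  · rw [Finset.Ico_eq_empty (by omega)]
    simp

theorem two_mul_eval_decompLeft (hr : r ≠ 0) (he : (e : ℤ) = d + 1 - h.natDegree) :
    2 * (decompLeft h r d e).eval x = ∑ k ∈ Finset.range e, evenSeq h r x d k := by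
  simp only [evenSeq, Finset.sum_add_distrib]
  rw [eval_decompLeft hr, two_mul]
  congr 1
  rw [← Finset.sum_range_reflect]
  refine Finset.sum_congr rfl fun k hk => ?_
  rw [Finset.mem_range] at hk
  congr 1
  omega

theorem two_mul_eval_decompRight (hr : r ≠ 0) (hx : x ≠ 0)
    (he : (e : ℤ) = d + 1 - h.natDegree) (he0 : e ≠ 0) :
    2 * (decompRight h r d e).eval x = ∑ k ∈ Finset.Ico e r, oddSeq h r x d k := by
  simp only [oddSeq, Finset.sum_add_distrib]
  rw [eval_decompRight hr hx he0, two_mul]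
  congr 1
  by_cases her : e ≤ r
  · refine Finset.sum_bij' (fun k _ => e + r - 1 - k) (fun k _ => e + r - 1 - k) ?_ ?_ ?_ ?_ ?_
    · intro k hk; rw [Finset.mem_Ico] at *; omega
    · intro k hk; rw [Finset.mem_Ico] at *; omega
    · intro k hk; rw [Finset.mem_Ico] at *; omega
    · intro k hk; rw [Finset.mem_Ico] at *; omega
    · intro k hk
      rw [Finset.mem_Ico] at hk
      congr 1
      omega
  · rw [Finset.Ico_eq_empty (by omega)]
    simp

theorem nonnegCoeffs_decompLeft (hr : r ≠ 0) (hnn : NonnegCoeffs h) :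
    NonnegCoeffs (decompLeft h r d e) :=
  NonnegCoeffs.sum fun k _ => nonnegCoeffs_sectionPoly hr hnn d k

theorem nonnegCoeffs_decompRight (hr : r ≠ 0) (hnn : NonnegCoeffs h) :
    NonnegCoeffs (decompRight h r d e) :=
  NonnegCoeffs.sum fun k _ => (nonnegCoeffs_sectionPoly hr hnn d k).divX

theorem coeff_zero_decompLeft_pos (hr : r ≠ 0) (hnn : NonnegCoeffs h) (h0 : 0 < h.coeff 0)
    (he0 : e ≠ 0) : 0 < (decompLeft h r d e).coeff 0 := by
  have h1 : 0 < (sectionPoly h r d 0).coeff 0 := by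
    rw [sectionPoly, coeff_contract hr, zero_mul, coeff_zero_eq_eval_zero]
    simp only [pow_zero, one_mul, eval_mul, eval_pow]
    rw [← coeff_zero_eq_eval_zero, ← coeff_zero_eq_eval_zero,
      coeff_geomPoly (Nat.pos_of_ne_zero hr), one_pow, mul_one]
    exact h0
  rw [decompLeft, finsetSum_coeff]
  exact h1.trans_le (Finset.single_le_sum
    (f := fun k => (sectionPoly h r d k).coeff 0)
    (fun k _ => nonnegCoeffs_sectionPoly hr hnn d k 0)
    (Finset.mem_range.2 (Nat.pos_of_ne_zero he0)))

/-- The values of `oddSeq` at a given position come from a symmetric polynomial. -/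
theorem exists_poly_oddSeq (hr : r ≠ 0) (hnn : NonnegCoeffs h) (h0 : 0 < h.coeff 0)
    (hpal : ∀ k ≤ h.natDegree, h.coeff (h.natDegree - k) = h.coeff k) (d : ℕ) {j : ℤ}
    (h1 : 1 ≤ j) (h2 : j ≤ r) (h3 : (d : ℤ) + 1 - h.natDegree ≤ j)
    (h4 : j + 1 ≤ d + 1 - h.natDegree + r) :
    ∃ P : ℝ[X], IsSymmetricPoly d P ∧ 0 < P.coeff 0 ∧
      ∀ x ≠ 0, P.eval x = oddSeq h r x (d + 1) j := by
  obtain ⟨k, rfl⟩ := Int.eq_ofNat_of_zero_le (show 0 ≤ j by omega)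
  obtain ⟨l, hl⟩ := Int.eq_ofNat_of_zero_le
    (show 0 ≤ ((d + 1 : ℕ) : ℤ) - h.natDegree - k + r by omega)
  have heval : ∀ x ≠ 0, ((sectionPoly h r (d + 1) l).divX +
      (sectionPoly h r (d + 1) k).divX).eval x = oddSeq h r x (d + 1) k := by
    intro x hx
    rw [eval_add, eval_divX_sectionPoly hr hx _ (by omega),
      eval_divX_sectionPoly hr hx _ (by omega), oddSeq]
    congr 2
    omega
  refine ⟨_, fun x hx => ?_, ?_, heval⟩
  · rw [heval x hx, heval x⁻¹ (inv_ne_zero hx)]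
    have := oddSeq_inv hr hx hpal (d + 1) k
    rw [pow_succ', mul_assoc] at this
    rw [zpow_natCast]
    exact (mul_left_cancel₀ hx this).symm
  · rw [coeff_add]
    exact add_pos (coeff_zero_divX_sectionPoly_pos hr hnn h0 d (by omega) (by omega))
      (coeff_zero_divX_sectionPoly_pos hr hnn h0 d (by omega) (by omega))

end

/-! ### Interlacing roots along the levels -/

section

open Filter Topology

theorem eventually_prod_sign_right {n i : ℕ} {ρ : ℕ → ℝ}
    (hρ : ∀ i, i + 1 < n → ρ (i + 1) < ρ i) (hi : i < n) :
    ∀ᶠ x in 𝓝[>] ρ i, 0 < (-1) ^ i * ∏ k ∈ Finset.range n, (x - ρ k) := by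
  have h1 : ∀ᶠ x in 𝓝[>] ρ i, ∀ k ∈ Finset.range i, x < ρ k := by
    rw [eventually_all_finset]
    intro k hk
    exact (eventually_lt_nhds (lt_of_succ_lt hρ (Finset.mem_range.1 hk) hi)).filter_mono
      nhdsWithin_le_nhds
  filter_upwards [h1, self_mem_nhdsWithin] with x hx hxi
  refine prod_sub_sign hi.le (fun k hk => hx k (Finset.mem_range.2 hk)) fun k hik hk => ?_
  rcases hik.eq_or_lt with rfl | hik
  · exact hxi
  · exact (lt_of_succ_lt hρ hik hk).trans hxi

theorem eventually_prod_sign_left {n i : ℕ} {ρ : ℕ → ℝ}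
    (hρ : ∀ i, i + 1 < n → ρ (i + 1) < ρ i) (hi : i < n) :
    ∀ᶠ x in 𝓝[<] ρ i, 0 < (-1) ^ (i + 1) * ∏ k ∈ Finset.range n, (x - ρ k) := by
  have h1 : ∀ᶠ x in 𝓝[<] ρ i, ∀ k ∈ Finset.Ico (i + 1) n, ρ k < x := by
    rw [eventually_all_finset]
    intro k hk
    rw [Finset.mem_Ico] at hk
    exact (eventually_gt_nhds (lt_of_succ_lt hρ hk.1 hk.2)).filter_mono nhdsWithin_le_nhds
  filter_upwards [h1, self_mem_nhdsWithin] with x hx hxi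
  refine prod_sub_sign hi (fun k hk => ?_) fun k hik hk => hx k (Finset.mem_Ico.2 ⟨hik, hk⟩)
  rcases (Nat.le_of_lt_succ hk).eq_or_lt with rfl | hki
  · exact hxi
  · exact (show x < ρ i from hxi).trans (lt_of_succ_lt hρ hki hi)

/-- On the side of a root that faces `-1`, the product with `1 + x` has a sign that depends only on
the index of the root. -/
theorem frequently_one_add_mul_prod_sign {n i : ℕ} {ρ : ℕ → ℝ}
    (hρ : ∀ i, i + 1 < n → ρ (i + 1) < ρ i) (hi : i < n) (h1 : ρ i ≠ -1) :
    ∃ᶠ x in 𝓝 (ρ i), 0 < (-1) ^ (i + 1) * ((1 + x) * ∏ k ∈ Finset.range n, (x - ρ k)) := by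
  rcases h1.lt_or_gt with h1 | h1
  · have h2 : ∀ᶠ x in 𝓝[>] ρ i, x < -1 :=
      (eventually_lt_nhds h1).filter_mono nhdsWithin_le_nhds
    refine Frequently.filter_mono (Eventually.frequently ?_) (nhdsWithin_le_nhds (s := Set.Ioi (ρ i)))
    filter_upwards [h2, eventually_prod_sign_right hρ hi] with x hx hx'
    rw [pow_succ]
    nlinarith
  · have h2 : ∀ᶠ x in 𝓝[<] ρ i, -1 < x :=
      (eventually_gt_nhds h1).filter_mono nhdsWithin_le_nhds
    refine Frequently.filter_mono (Eventually.frequently ?_) (nhdsWithin_le_nhds (s := Set.Iio (ρ i)))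
    filter_upwards [h2, eventually_prod_sign_left hρ hi] with x hx hx'
    nlinarith

variable {h : ℝ[X]} {r d : ℕ} {x : ℝ}

theorem continuousAt_evenSeq (hx : x ≠ 0) (d : ℕ) (j : ℤ) :
    ContinuousAt (fun x => evenSeq h r x d j) x :=
  (continuousAt_sectionSeq hx d _).add (continuousAt_sectionSeq hx d _)

theorem continuousAt_oddSeq (hx : x ≠ 0) (d : ℕ) (j : ℤ) :
    ContinuousAt (fun x => oddSeq h r x d j) x :=
  (continuousAt_sectionSeq hx d _).add (continuousAt_sectionSeq hx d _)

/-- By the symmetry of `evenSeq`, what holds on the half period holds on a full one. -/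
theorem evenSeq_window {P : ℝ → Prop} {d : ℕ}
    (hP : ∀ j, HalfPeriod (d - h.natDegree) r j → P (evenSeq h r x d j)) {j : ℤ}
    (h1 : (d : ℤ) - h.natDegree - r ≤ 2 * j) (h2 : 2 * j ≤ d - h.natDegree + r) :
    P (evenSeq h r x d j) := by
  by_cases h3 : (d : ℤ) - h.natDegree ≤ 2 * j
  · exact hP j ⟨h3, h2⟩
  · rw [← evenSeq_symm]
    exact hP _ ⟨by omega, by omega⟩

/-- By the symmetry of `oddSeq`, what holds on the half period holds on a full one. -/
theorem oddSeq_window {P : ℝ → Prop} {d : ℕ}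
    (hP : ∀ j, HalfPeriod (d - h.natDegree) r j → P (oddSeq h r x d j)) {j : ℤ}
    (h1 : (d : ℤ) - h.natDegree ≤ 2 * j) (h2 : 2 * j ≤ d - h.natDegree + 2 * r) :
    P (oddSeq h r x d j) := by
  by_cases h3 : 2 * j ≤ (d : ℤ) - h.natDegree + r
  · exact hP j ⟨h1, h3⟩
  · rw [← oddSeq_symm]
    exact hP _ ⟨by omega, by omega⟩

/-- The least integer of the half period of level `d`. -/
def leftEnd (h : ℝ[X]) (d : ℕ) : ℤ := (d - h.natDegree + 1) / 2

/-- The greatest integer of the half period of level `d`. -/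
def rightEnd (h : ℝ[X]) (r d : ℕ) : ℤ := (d - h.natDegree + r) / 2

theorem halfPeriod_leftEnd (hr : r ≠ 0) : HalfPeriod (d - h.natDegree) r (leftEnd h d) := by
  unfold HalfPeriod leftEnd; omega

theorem halfPeriod_rightEnd (hr : r ≠ 0) : HalfPeriod (d - h.natDegree) r (rightEnd h r d) := by
  unfold HalfPeriod rightEnd; omega

theorem mul_nonneg_of_sameSign {s a b : ℝ} (hs : s = 1 ∨ s = -1) (ha : 0 ≤ s * a)
    (hb : 0 ≤ s * b) : 0 ≤ a * b := by
  have := mul_nonneg ha hb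
  rcases hs with rfl | rfl <;> linarith

/-- The hypotheses on `h` and `r` under which the roots are located: `h` has nonnegative palindromic
coefficients, its degree is at most `r`, and the cases `h = 0` and `r = 1` are excluded. -/
structure Admissible (h : ℝ[X]) (r : ℕ) : Prop where
  two_le : 2 ≤ r
  nonneg : NonnegCoeffs h
  palindromic : ∀ k ≤ h.natDegree, h.coeff (h.natDegree - k) = h.coeff k
  natDegree_le : h.natDegree ≤ r
  coeff_zero_pos : 0 < h.coeff 0

namespace Admissible

theorem ne_zero (H : Admissible h r) : r ≠ 0 := by
  have := H.two_le
  omega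

/-- If near `x` there are arguments at which `(1 + y) * oddSeq` at the right end and `evenSeq` at the
left end have the same sign, then all values of `evenSeq` at `x` have the sign of the one at the left
end. At `x = -1`, where the factor `1 + x` vanishes, nothing has to be assumed. -/
theorem evenSeq_mul_nonneg (H : Admissible h r) (hx : x < 0)
    (hf : x ≠ -1 → ∃ᶠ y in 𝓝 x,
      0 < (1 + y) * oddSeq h r y d (rightEnd h r d) * evenSeq h r y d (leftEnd h d))
    {j : ℤ} (h1 : (d : ℤ) - h.natDegree - r ≤ 2 * j) (h2 : 2 * j ≤ d - h.natDegree + r) :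
    0 ≤ evenSeq h r x d j * evenSeq h r x d (leftEnd h d) := by
  by_cases hx1 : x = -1
  · subst hx1
    obtain ⟨s, hs, hs'⟩ :=
      (sameSign_neg_one H.ne_zero H.nonneg H.palindromic H.natDegree_le d).1
    refine evenSeq_window (P := fun t => 0 ≤ t * evenSeq h r (-1) d (leftEnd h d))
      (fun i hi => ?_) h1 h2
    exact mul_nonneg_of_sameSign hs (hs' i hi) (hs' _ (halfPeriod_leftEnd H.ne_zero))
  · by_contra hcon
    have hc : ContinuousAt (fun y => evenSeq h r y d j * evenSeq h r y d (leftEnd h d)) x :=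
      (continuousAt_evenSeq hx.ne d j).mul (continuousAt_evenSeq hx.ne d _)
    obtain ⟨y, hy, hy1, hy2⟩ := ((hf hx1).and_eventually
      ((hc.eventually (eventually_lt_nhds (not_le.1 hcon))).and (eventually_lt_nhds hx))).exists
    refine absurd ?_ (not_le.2 hy1)
    refine evenSeq_window (P := fun t => 0 ≤ t * evenSeq h r y d (leftEnd h d))
      (fun i hi => ?_) h1 h2
    exact (oneSignChange H.ne_zero hy2 H.nonneg H.palindromic H.natDegree_le d).left_mul_nonneg
      (halfPeriod_leftEnd H.ne_zero) (by unfold leftEnd; omega)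
      (halfPeriod_rightEnd H.ne_zero) hy hi

/-- If near `x` there are arguments at which `(1 + y) * oddSeq` at the right end and some value of
`evenSeq` have opposite signs, then all values of `oddSeq` at `x` have the sign of the one at the
right end. -/
theorem oddSeq_mul_nonneg (H : Admissible h r) (hx : x < 0)
    (hf : x ≠ -1 → ∃ᶠ y in 𝓝 x, ∃ i : ℤ, (d : ℤ) - h.natDegree - r ≤ 2 * i ∧
      2 * i ≤ d - h.natDegree + r ∧
      evenSeq h r y d i * ((1 + y) * oddSeq h r y d (rightEnd h r d)) < 0)
    {j : ℤ} (h1 : (d : ℤ) - h.natDegree ≤ 2 * j) (h2 : 2 * j ≤ d - h.natDegree + 2 * r) :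
    0 ≤ oddSeq h r x d j * oddSeq h r x d (rightEnd h r d) := by
  by_cases hx1 : x = -1
  · subst hx1
    obtain ⟨s, hs, hs'⟩ :=
      (sameSign_neg_one H.ne_zero H.nonneg H.palindromic H.natDegree_le d).2
    refine oddSeq_window (P := fun t => 0 ≤ t * oddSeq h r (-1) d (rightEnd h r d))
      (fun i hi => ?_) h1 h2
    exact mul_nonneg_of_sameSign hs (hs' i hi) (hs' _ (halfPeriod_rightEnd H.ne_zero))
  · by_contra hcon
    have hc : ContinuousAt (fun y => oddSeq h r y d j * oddSeq h r y d (rightEnd h r d)) x :=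
      (continuousAt_oddSeq hx.ne d j).mul (continuousAt_oddSeq hx.ne d _)
    obtain ⟨y, ⟨i, hi1, hi2, hy⟩, hy1, hy2⟩ := ((hf hx1).and_eventually
      ((hc.eventually (eventually_lt_nhds (not_le.1 hcon))).and (eventually_lt_nhds hx))).exists
    have hone := oneSignChange H.ne_zero hy2 H.nonneg H.palindromic H.natDegree_le d
    refine absurd ?_ (not_le.2 hy1)
    refine oddSeq_window (P := fun t => 0 ≤ t * oddSeq h r y d (rightEnd h r d))
      (fun k hk => ?_) h1 h2
    have hkey : 0 ≤ (1 + y) * oddSeq h r y d k * ((1 + y) * oddSeq h r y d (rightEnd h r d)) := by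
      by_contra hcon'
      refine not_le.2 hy (evenSeq_window
        (P := fun t => 0 ≤ t * ((1 + y) * oddSeq h r y d (rightEnd h r d))) (fun l hl => ?_)
        hi1 hi2)
      by_contra hcon''
      exact hcon' (hone.right_mul_nonneg hl (halfPeriod_rightEnd H.ne_zero)
        (by unfold rightEnd; omega) (not_le.1 hcon'') hk)
    have hy1' : 1 + y ≠ 0 := by
      intro h0
      rw [h0] at hy
      simp at hy
    have : 0 < (1 + y) ^ 2 := by positivity
    by_contra hcon'
    nlinarith

end Admissible

/-- The inductive statement about level `d + 1`: the value of `oddSeq` at the right end is, as a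
function of the argument, a polynomial with `d` negative roots, and at these roots the value of
`evenSeq` at the left end alternates in sign. -/
structure AlternatingRoots (h : ℝ[X]) (r d : ℕ) (c : ℝ) (ρ : ℕ → ℝ) : Prop where
  pos : 0 < c
  neg : ∀ i < d, ρ i < 0
  anti : ∀ i, i + 1 < d → ρ (i + 1) < ρ i
  eval : ∀ x < 0, oddSeq h r x (d + 1) (rightEnd h r (d + 1)) =
    c * ∏ i ∈ Finset.range d, (x - ρ i)
  sign : ∀ i < d, 0 < (-1) ^ (i + 1) * evenSeq h r (ρ i) (d + 1) (leftEnd h (d + 1))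

/-- If a polynomial of the right degree is a sum of values of `evenSeq`, its roots interlace those
of `oddSeq` at the right end, and at its roots `oddSeq` alternates in sign. -/
theorem AlternatingRoots.exists_roots {c : ℝ} {ρ : ℕ → ℝ} (T : AlternatingRoots h r d c ρ)
    (H : Admissible h r) {ι : Type*} {S : Finset ι} {φ : ι → ℤ}
    (hφ1 : ∀ i ∈ S, ((d + 1 : ℕ) : ℤ) - h.natDegree - r ≤ 2 * φ i)
    (hφ2 : ∀ i ∈ S, 2 * φ i ≤ (d + 1 : ℕ) - h.natDegree + r)
    (hφ : ∃ i ∈ S, φ i = leftEnd h (d + 1)) {κ : ℝ} (hκ : 0 < κ) {P : ℝ[X]}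
    (hP : ∀ x < 0, κ * P.eval x = ∑ i ∈ S, evenSeq h r x (d + 1) (φ i))
    (hdeg : P.natDegree = d + 1) (hlead : 0 < P.leadingCoeff) (h0 : 0 < P.coeff 0) :
    ∃ ρ' : ℕ → ℝ, (∀ i < d + 1, ρ' i < 0) ∧ (∀ i, i + 1 < d + 1 → ρ' (i + 1) < ρ' i) ∧
      P = C P.leadingCoeff * ∏ i ∈ Finset.range (d + 1), (X - C (ρ' i)) ∧
      ∀ i < d + 1, 0 < (-1) ^ i * oddSeq h r (ρ' i) (d + 1) (rightEnd h r (d + 1)) ∧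
        ∀ j : ℤ, ((d + 1 : ℕ) : ℤ) - h.natDegree ≤ 2 * j →
          2 * j ≤ (d + 1 : ℕ) - h.natDegree + 2 * r →
          0 ≤ (-1) ^ i * oddSeq h r (ρ' i) (d + 1) j := by
  have hsq : ∀ i : ℕ, (-1 : ℝ) ^ i * (-1) ^ i = 1 := fun i => by
    rw [← mul_pow]; norm_num
  -- At a root of `oddSeq`, all values of `evenSeq` have the sign of the value at the left end.
  have hstep : ∀ i < d, 0 < (-1) ^ (i + 1) * P.eval (ρ i) := by
    intro i hi
    have hneg := T.neg i hi
    have hsign := T.sign i hi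
    have hnn : ∀ j ∈ S, 0 ≤ (-1) ^ (i + 1) * evenSeq h r (ρ i) (d + 1) (φ j) := by
      intro j hj
      have h1 : 0 ≤ evenSeq h r (ρ i) (d + 1) (φ j) *
          evenSeq h r (ρ i) (d + 1) (leftEnd h (d + 1)) := by
        refine H.evenSeq_mul_nonneg hneg (fun hne => ?_) (hφ1 j hj) (hφ2 j hj)
        have hc := (continuousAt_evenSeq (h := h) (r := r) hneg.ne (d + 1)
          (leftEnd h (d + 1))).const_mul ((-1) ^ (i + 1))
        refine ((frequently_one_add_mul_prod_sign T.anti hi hne).and_eventually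
          ((hc.eventually (eventually_gt_nhds hsign)).and (eventually_lt_nhds hneg))).mono ?_
        rintro y ⟨hy1, hy2, hy3⟩
        rw [T.eval y hy3]
        have := mul_pos T.pos (mul_pos hy1 hy2)
        calc (0 : ℝ) < _ := this
          _ = ((-1) ^ (i + 1) * (-1) ^ (i + 1)) * ((1 + y) *
            (c * ∏ k ∈ Finset.range d, (y - ρ k)) *
              evenSeq h r y (d + 1) (leftEnd h (d + 1))) := by ring
          _ = _ := by rw [hsq, one_mul]
      by_contra hcon
      have := mul_neg_of_neg_of_pos (not_le.1 hcon) hsign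
      have h2 : (-1 : ℝ) ^ (i + 1) * evenSeq h r (ρ i) (d + 1) (φ j) *
          ((-1) ^ (i + 1) * evenSeq h r (ρ i) (d + 1) (leftEnd h (d + 1))) =
          ((-1) ^ (i + 1) * (-1) ^ (i + 1)) * (evenSeq h r (ρ i) (d + 1) (φ j) *
          evenSeq h r (ρ i) (d + 1) (leftEnd h (d + 1))) := by ring
      rw [h2, hsq, one_mul] at this
      linarith
    have hsum : 0 < κ * ((-1) ^ (i + 1) * P.eval (ρ i)) := by
      rw [mul_left_comm, hP _ hneg, Finset.mul_sum]
      obtain ⟨j, hj, hj'⟩ := hφ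
      exact Finset.sum_pos' hnn ⟨j, hj, by rw [hj']; exact hsign⟩
    exact pos_of_mul_pos_right hsum hκ.le
  -- `P` changes sign between consecutive ones of the points `0`, `ρ 0, …, ρ (d - 1)` and a point
  -- `z` near `-∞`.
  obtain ⟨z, hz, hz'⟩ := exists_lt_sign_pos hlead (if d = 0 then 0 else ρ (d - 1))
  rw [hdeg] at hz'
  set y : ℕ → ℝ := fun i => if i = 0 then 0 else if i ≤ d then ρ (i - 1) else z with hy
  have hy0 : y 0 = 0 := by simp [hy]
  have hy1 : ∀ i < d, y (i + 1) = ρ i := by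
    intro i hi
    simp only [hy]
    rw [if_neg (by omega), if_pos (by omega), Nat.add_sub_cancel]
  have hy2 : y (d + 1) = z := by
    simp only [hy]
    rw [if_neg (by omega), if_neg (by omega)]
  have hyanti : ∀ i < d + 1, y (i + 1) < y i := by
    intro i hi
    rcases i with _ | i
    · rw [hy0]
      rcases Nat.eq_zero_or_pos d with hd | hd
      · subst hd
        rw [zero_add, ← zero_add 1, hy2]
        simpa using hz
      · rw [hy1 0 hd]
        exact T.neg 0 hd
    · rw [hy1 i (by omega)]
      rcases (show i + 1 ≤ d by omega).eq_or_lt with hd | hd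
      · rw [hd, hy2]
        rw [if_neg (by omega)] at hz
        rwa [← hd, Nat.add_sub_cancel] at hz
      · rw [hy1 (i + 1) hd]
        exact T.anti i hd
  have hysign : ∀ i ≤ d + 1, 0 < (-1) ^ i * P.eval (y i) := by
    intro i hi
    rcases i with _ | i
    · rw [hy0, ← coeff_zero_eq_eval_zero, pow_zero, one_mul]
      exact h0
    · rcases (show i ≤ d by omega).eq_or_lt with hd | hd
      · rw [hd, hy2]
        exact hz'
      · rw [hy1 i hd]
        exact hstep i hd
  obtain ⟨ρ', hρ', -, hfac⟩ := exists_roots_of_sign_changes hyanti hysign hdeg.le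
  have hneg' : ∀ i < d + 1, ρ' i < 0 := by
    intro i hi
    refine (hρ' i hi).2.trans_le ?_
    rcases i with _ | i
    · exact hy0.le
    · rw [hy1 i (by omega)]
      exact (T.neg i (by omega)).le
  have hanti' : ∀ i, i + 1 < d + 1 → ρ' (i + 1) < ρ' i := fun i hi =>
    (hρ' (i + 1) hi).2.trans (hρ' i (by omega)).1
  have hPeval : ∀ x, P.eval x =
      P.leadingCoeff * ∏ k ∈ Finset.range (d + 1), (x - ρ' k) := by
    intro x
    conv_lhs => rw [hfac]
    simp [eval_prod]
  refine ⟨ρ', hneg', hanti', hfac, fun i hi => ?_⟩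
  have hneg := hneg' i hi
  have hodd : 0 < (-1) ^ i * oddSeq h r (ρ' i) (d + 1) (rightEnd h r (d + 1)) := by
    rw [T.eval _ hneg, mul_left_comm]
    refine mul_pos T.pos (prod_sub_sign (by omega) (fun k hk => ?_) fun k hik hk => ?_)
    · rw [← hy1 k (by omega)]
      refine (hρ' i hi).2.trans_le ?_
      rcases (show k + 1 ≤ i by omega).eq_or_lt with hki | hki
      · rw [hki]
      · exact (lt_of_succ_lt (n := d + 2) (fun l hl => hyanti l (by omega)) hki (by omega)).le
    · rw [← hy1 k hk]
      refine lt_of_le_of_lt ?_ (hρ' i hi).1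
      rcases hik.eq_or_lt with rfl | hki
      · exact le_rfl
      · exact (lt_of_succ_lt (n := d + 2) (ρ := y) (fun l hl => hyanti l (by omega))
          (show i + 1 < k + 1 by omega) (by omega)).le
  refine ⟨hodd, fun j hj1 hj2 => ?_⟩
  have h1 : 0 ≤ oddSeq h r (ρ' i) (d + 1) j *
      oddSeq h r (ρ' i) (d + 1) (rightEnd h r (d + 1)) := by
    refine H.oddSeq_mul_nonneg hneg (fun hne => ?_) hj1 hj2
    have hc := (continuousAt_oddSeq (h := h) (r := r) hneg.ne (d + 1)
      (rightEnd h r (d + 1))).const_mul ((-1) ^ i)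
    refine ((frequently_one_add_mul_prod_sign hanti' hi hne).and_eventually
      ((hc.eventually (eventually_gt_nhds hodd)).and (eventually_lt_nhds hneg))).mono ?_
    rintro y ⟨hy1, hy2, hy3⟩
    by_contra hcon
    push Not at hcon
    have h2 : 0 ≤ ∑ k ∈ S, evenSeq h r y (d + 1) (φ k) *
        ((1 + y) * oddSeq h r y (d + 1) (rightEnd h r (d + 1))) :=
      Finset.sum_nonneg fun k hk => hcon _ (hφ1 k hk) (hφ2 k hk)
    rw [← Finset.sum_mul, ← hP y hy3, hPeval] at h2
    have h3 := mul_pos (mul_pos hκ hlead) (mul_pos hy1 hy2)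
    have h4 : κ * P.leadingCoeff * ((-1) ^ (i + 1) *
        ((1 + y) * ∏ k ∈ Finset.range (d + 1), (y - ρ' k)) *
        ((-1) ^ i * oddSeq h r y (d + 1) (rightEnd h r (d + 1)))) =
        -(((-1) ^ i * (-1) ^ i) * (κ * (P.leadingCoeff *
        ∏ k ∈ Finset.range (d + 1), (y - ρ' k)) *
        ((1 + y) * oddSeq h r y (d + 1) (rightEnd h r (d + 1))))) := by ring
    rw [h4, hsq, one_mul] at h3
    linarith
  by_contra hcon
  have := mul_neg_of_neg_of_pos (not_le.1 hcon) hodd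
  have h2 : (-1 : ℝ) ^ i * oddSeq h r (ρ' i) (d + 1) j *
      ((-1) ^ i * oddSeq h r (ρ' i) (d + 1) (rightEnd h r (d + 1))) =
      ((-1) ^ i * (-1) ^ i) * (oddSeq h r (ρ' i) (d + 1) j *
      oddSeq h r (ρ' i) (d + 1) (rightEnd h r (d + 1))) := by ring
  rw [h2, hsq, one_mul] at this
  linarith

/-- The passage to the next level: `oddSeq` at the right end of level `d + 2` is a sum of values of
`evenSeq` on level `d + 1`, and `evenSeq` at the left end is `x` times a sum of values of `oddSeq`. -/
theorem AlternatingRoots.succ {c : ℝ} {ρ : ℕ → ℝ} (T : AlternatingRoots h r d c ρ)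
    (H : Admissible h r) (hd : (d : ℤ) + 2 - h.natDegree ≤ r) :
    ∃ c' ρ', AlternatingRoots h r (d + 1) c' ρ' := by
  have h2 := H.two_le
  have hs := H.natDegree_le
  obtain ⟨P, hsymm, hP0, hPe⟩ := exists_poly_oddSeq H.ne_zero H.nonneg H.coeff_zero_pos
    H.palindromic (d + 1) (j := rightEnd h r (d + 2)) (by unfold rightEnd; omega)
    (by unfold rightEnd; omega) (by unfold rightEnd; omega) (by unfold rightEnd; omega)
  have hlead : 0 < P.leadingCoeff := by rw [hsymm.leadingCoeff_eq hP0.ne']; exact hP0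
  obtain ⟨ρ', h3, h4, h5, h6⟩ := T.exists_roots H (S := Finset.range r)
    (φ := fun m => rightEnd h r (d + 2) - r + m) (κ := 1) (P := P)
    (fun i _ => by unfold rightEnd; omega)
    (fun i hi => by have := Finset.mem_range.1 hi; unfold rightEnd; omega)
    ⟨(leftEnd h (d + 1) - rightEnd h r (d + 2) + r).toNat, by
      rw [Finset.mem_range]; unfold leftEnd rightEnd; omega, by
      unfold leftEnd rightEnd; omega⟩
    one_pos (fun x hx => by rw [one_mul, hPe x hx.ne, oddSeq_succ])
    (hsymm.natDegree_eq hP0.ne') hlead hP0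
  refine ⟨P.leadingCoeff, ρ', hlead, h3, h4, fun x hx => ?_, fun i hi => ?_⟩
  · rw [← hPe x hx.ne]
    conv_lhs => rw [h5]
    simp [eval_prod]
  · obtain ⟨h7, h8⟩ := h6 i hi
    rw [evenSeq_succ H.ne_zero (h3 i hi).ne, pow_succ,
      show ∀ a b : ℝ, (-1) ^ i * -1 * (a * b) = -a * ((-1) ^ i * b) by intro a b; ring]
    refine mul_pos (by linarith [h3 i hi]) ?_
    rw [Finset.mul_sum]
    refine Finset.sum_pos' (fun m hm => h8 _ (by unfold leftEnd; omega)
      (by have := Finset.mem_range.1 hm; unfold leftEnd; omega))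
      ⟨(rightEnd h r (d + 1) - leftEnd h (d + 2)).toNat, ?_, ?_⟩
    · rw [Finset.mem_range]; unfold leftEnd rightEnd; omega
    · rw [show leftEnd h (d + 1 + 1) +
        ((rightEnd h r (d + 1) - leftEnd h (d + 2)).toNat : ℤ) = rightEnd h r (d + 1) by
          unfold leftEnd rightEnd; omega]
      exact h7

theorem alternatingRoots_one (H : Admissible h r) (hs : h.natDegree < r) :
    ∃ c ρ, AlternatingRoots h r 0 c ρ := by
  refine ⟨2 * ∑ k ∈ Finset.range (h.natDegree + 1), h.coeff k, fun _ => 0, ?_, by simp, by simp,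
    fun x hx => ?_, by simp⟩
  · refine mul_pos two_pos (Finset.sum_pos' (fun k _ => H.nonneg k) ⟨0, by simp, ?_⟩)
    exact H.coeff_zero_pos
  · have h1 := mul_oddSeq_one H.ne_zero hx.ne H.palindromic (j := rightEnd h r 1)
      (by unfold rightEnd; omega) (by unfold rightEnd; omega)
    refine mul_left_cancel₀ hx.ne ?_
    rw [zero_add, h1, Finset.range_zero, Finset.prod_empty, Finset.mul_sum, mul_one, Finset.mul_sum]
    refine Finset.sum_congr rfl fun k _ => ?_
    rw [if_neg (by unfold rightEnd; omega)]
    ring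

/-- When `deg h = r`, the induction starts at the second level, and needs a middle coefficient of
`h` to be nonzero. -/
theorem alternatingRoots_two (H : Admissible h r) (hs : h.natDegree = r) {k : ℕ} (hk0 : 0 < k)
    (hkr : k < r) (hk : 0 < h.coeff k) : ∃ c ρ, AlternatingRoots h r 1 c ρ := by
  have h2 := H.two_le
  obtain ⟨P, hsymm, hP0, hPe⟩ := exists_poly_oddSeq H.ne_zero H.nonneg H.coeff_zero_pos
    H.palindromic 1 (j := rightEnd h r 2) (by unfold rightEnd; omega)
    (by unfold rightEnd; omega) (by unfold rightEnd; omega) (by unfold rightEnd; omega)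
  refine ⟨P.coeff 0, fun _ => -1, hP0, fun _ _ => by norm_num, fun i hi => by omega,
    fun x hx => ?_, fun i hi => ?_⟩
  · rw [← hPe x hx.ne, eq_X_add_C_of_natDegree_le_one hsymm.natDegree_le,
      ← hsymm.coeff_sub (Nat.zero_le 1)]
    simp
    ring
  · obtain rfl : i = 0 := by omega
    have hneg : ∀ d j, evenSeq h r (-1) d j + evenSeq h r (-1) d (d - h.natDegree + r - j) = 0 := by
      intro d j
      rw [evenSeq_add H.ne_zero (by norm_num)]
      norm_num
    obtain ⟨l, hl0, hlr, hl⟩ : ∃ l : ℕ, 0 < l ∧ 2 * l ≤ r ∧ 0 < h.coeff l := by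
      by_cases hkk : 2 * k ≤ r
      · exact ⟨k, hk0, hkk, hk⟩
      · refine ⟨r - k, by omega, by omega, ?_⟩
        rw [← hs, H.palindromic k (by omega)]
        exact hk
    have hpos : 0 < evenSeq h r (-1) 0 (-l) := by
      refine add_pos_of_pos_of_nonneg ?_
        (sectionSeq_zero_nonneg H.nonneg (by push_cast; omega) (by push_cast; omega))
      rw [sectionSeq_zero_of_lt (by omega) (by omega)]
      refine Finset.sum_pos' (fun m _ => ?_) ⟨l, by rw [Finset.mem_range]; omega, ?_⟩
      · split_ifs
        exacts [H.nonneg m, le_rfl]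
      · rw [if_pos (by omega)]
        exact hl
    have hN : ((2 : ℕ) : ℤ) - h.natDegree = (0 : ℕ) - h.natDegree + 2 := by push_cast; ring
    have key := neg_of_symm_antisymm (N := (0 : ℕ) - h.natDegree) (r := r) (K := ((-1 : ℝ) - 1) ^ 2)
      (a := fun j => evenSeq h r (-1) (0 + 2) (j + 1)) (e := fun j => evenSeq h r (-1) 0 j)
      (by norm_num) (fun j => ?_) (fun j => ?_) (fun j => evenSeq_symm 0 j)
      (fun j => evenSeq_second_difference (h := h) H.ne_zero (by norm_num) 0 j) (fun j hj => ?_)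
      (i := -l) (m := leftEnd h 2 - 1) (by push_cast; omega) (by push_cast; omega) hpos
      (by unfold leftEnd; push_cast; omega) (by unfold leftEnd; push_cast; omega)
    · simp only [sub_add_cancel, zero_add] at key
      simpa using key
    · rw [← evenSeq_symm (0 + 2)]
      congr 1
      push_cast
      ring
    · rw [← hneg 2 (j + 1), hN]
      congr 2
      ring
    · rcases halfPeriod_zero_cases H.natDegree_le hj with ⟨h3, h4⟩ | ⟨-, rfl⟩
      · exact evenSeq_zero_nonneg H.nonneg h3 h4
      · have h3 := hneg 0 0
        rw [hs] at h3
        simp only [Nat.cast_zero, zero_sub, neg_add_cancel, sub_zero] at h3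
        linarith

theorem exists_alternatingRoots (H : Admissible h r) (hd : (d : ℤ) + 1 - h.natDegree ≤ r)
    (hs : h.natDegree < r ∨ (1 ≤ d ∧ h.natDegree = r ∧ ∃ k, 0 < k ∧ k < r ∧ 0 < h.coeff k)) :
    ∃ c ρ, AlternatingRoots h r d c ρ := by
  rcases hs with hs | ⟨hd1, hs, k, hk0, hkr, hk⟩
  · induction d with
    | zero => exact alternatingRoots_one H hs
    | succ d ih =>
      obtain ⟨c, ρ, T⟩ := ih (by push_cast at hd; omega)
      exact T.succ H (by push_cast at hd; omega)
  · induction d, hd1 using Nat.le_induction with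
    | base => exact alternatingRoots_two H hs hk0 hkr hk
    | succ d _ ih =>
      obtain ⟨c, ρ, T⟩ := ih (by push_cast at hd; omega)
      exact T.succ H (by push_cast at hd; omega)

end

/-! ### The interlacing of the two parts -/

section

open Filter Topology

variable {h : ℝ[X]} {r d e : ℕ}

/-- `P` and `Q` have constant coefficients as leading coefficients and factor completely, with `d + 1`
nonpositive roots for `P`, and `d` roots for `Q` that separate those of `P` (weakly). Here `Q` may be
zero. -/
def SeparatedRoots (d : ℕ) (P Q : ℝ[X]) (ρ σ : ℕ → ℝ) : Prop :=
  (∀ i < d + 1, ρ i ≤ 0) ∧ (∀ i < d, σ i ≤ ρ i) ∧ (∀ i < d, ρ (i + 1) ≤ σ i) ∧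
    P = C (P.coeff 0) * ∏ i ∈ Finset.range (d + 1), (X - C (ρ i)) ∧
    Q = C (Q.coeff 0) * ∏ i ∈ Finset.range d, (X - C (σ i))

/-- The roots of the two parts, in the cases in which the induction along the levels has a start. -/
theorem Admissible.separatedRoots_of_generic (H : Admissible h r)
    (he : (e : ℤ) = (d + 1 : ℕ) + 1 - h.natDegree) (he0 : e ≠ 0) (her : e ≤ r)
    (hs : h.natDegree < r ∨ (1 ≤ d ∧ h.natDegree = r ∧ ∃ k, 0 < k ∧ k < r ∧ 0 < h.coeff k)) :
    ∃ ρ σ, SeparatedRoots d (decompLeft h r (d + 1) e) (decompRight h r (d + 1) e) ρ σ := by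
  obtain ⟨c, ρ₀, T⟩ := exists_alternatingRoots H (d := d) (by omega) hs
  have hp := isSymmetricPoly_decompLeft H.ne_zero H.palindromic he
  have hp0 := coeff_zero_decompLeft_pos (d := d + 1) H.ne_zero H.nonneg H.coeff_zero_pos he0
  have hlead := hp.leadingCoeff_eq hp0.ne'
  obtain ⟨ρ, h1, h2, h3, h4⟩ := T.exists_roots H (S := Finset.range e) (φ := fun k => (k : ℤ))
    (κ := 2) (P := decompLeft h r (d + 1) e) (fun i _ => by omega)
    (fun i hi => by have := Finset.mem_range.1 hi; omega)
    ⟨(leftEnd h (d + 1)).toNat, by rw [Finset.mem_range]; unfold leftEnd; omega, by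
      unfold leftEnd; omega⟩ two_pos
    (fun x _ => two_mul_eval_decompLeft H.ne_zero he) (hp.natDegree_eq hp0.ne')
    (hlead ▸ hp0) hp0
  rw [hlead] at h3
  rcases her.eq_or_lt with her' | her'
  · have hq : decompRight h r (d + 1) e = 0 := by simp [decompRight, her']
    refine ⟨ρ, ρ, fun i hi => (h1 i hi).le, fun i _ => le_rfl, fun i hi => (h2 i (by omega)).le,
      h3, ?_⟩
    rw [hq]
    simp
  · have hq : IsSymmetricPoly (d : ℕ) (decompRight h r (d + 1) e) := by
      have := isSymmetricPoly_decompRight H.ne_zero H.palindromic he he0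
      rwa [Nat.cast_succ, add_sub_cancel_right] at this
    have hsign : ∀ i ≤ d, 0 < (-1) ^ i * (decompRight h r (d + 1) e).eval (ρ i) := by
      intro i hi
      obtain ⟨h5, h6⟩ := h4 i (by omega)
      have h7 := two_mul_eval_decompRight (h := h) H.ne_zero (h1 i (by omega)).ne he he0
      have h8 : 0 < (-1) ^ i * (2 * (decompRight h r (d + 1) e).eval (ρ i)) := by
        rw [h7, Finset.mul_sum]
        refine Finset.sum_pos' (fun k hk => ?_) ⟨(rightEnd h r (d + 1)).toNat, ?_, ?_⟩
        · rw [Finset.mem_Ico] at hk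
          exact h6 _ (by omega) (by omega)
        · rw [Finset.mem_Ico]; unfold rightEnd; omega
        · rw [show ((rightEnd h r (d + 1)).toNat : ℤ) = rightEnd h r (d + 1) by
            unfold rightEnd; omega]
          exact h5
      linarith
    obtain ⟨σ, h5, h6, h7⟩ := exists_roots_of_sign_changes (fun i hi => h2 i (by omega)) hsign
      hq.natDegree_le
    have hlead' : (decompRight h r (d + 1) e).leadingCoeff =
        (decompRight h r (d + 1) e).coeff 0 := by
      rw [leadingCoeff, h6]
      simpa using hq.coeff_sub (Nat.zero_le d)
    rw [hlead'] at h7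
    exact ⟨ρ, σ, fun i hi => (h1 i hi).le, fun i hi => (h5 i hi).2.le, fun i hi => (h5 i hi).1.le,
      h3, h7⟩

/-- Separated roots persist in the limit: the roots of `P n` stay bounded, as they are nonpositive
and so every factor `1 - ρ n i` of `P n` at `1` is at least `1`. -/
theorem exists_separatedRoots_of_tendsto {p q : ℝ[X]} {P Q : ℕ → ℝ[X]} {ρ σ : ℕ → ℕ → ℝ}
    (hP : ∀ x, Tendsto (fun n => (P n).eval x) atTop (𝓝 (p.eval x)))
    (hQ : ∀ x, Tendsto (fun n => (Q n).eval x) atTop (𝓝 (q.eval x)))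
    (hp : 0 < p.coeff 0) (hPn : ∀ n, 0 < (P n).coeff 0)
    (hsep : ∀ n, SeparatedRoots d (P n) (Q n) (ρ n) (σ n)) :
    ∃ ρ' σ', SeparatedRoots d p q ρ' σ' := by
  simp only [coeff_zero_eq_eval_zero] at hp hPn
  have hPe : ∀ n x, (P n).eval x =
      (P n).eval 0 * ∏ i ∈ Finset.range (d + 1), (x - ρ n i) := by
    intro n x
    conv_lhs => rw [(hsep n).2.2.2.1]
    simp [eval_prod, coeff_zero_eq_eval_zero]
  have hQe : ∀ n x, (Q n).eval x = (Q n).eval 0 * ∏ i ∈ Finset.range d, (x - σ n i) := by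
    intro n x
    conv_lhs => rw [(hsep n).2.2.2.2]
    simp [eval_prod, coeff_zero_eq_eval_zero]
  -- The value at `1` bounds the roots.
  obtain ⟨B, hB⟩ := ((hP 1).div (hP 0) hp.ne').bddAbove_range
  have hbound : ∀ n, ∀ i < d + 1, ρ n i ∈ Set.Icc (1 - B) 0 := by
    intro n i hi
    have hn := (hsep n).1
    refine ⟨?_, hn i hi⟩
    have h1 : (P n).eval 1 / (P n).eval 0 ≤ B := hB ⟨n, rfl⟩
    rw [hPe n 1, mul_div_cancel_left₀ _ (hPn n).ne',
      ← Finset.mul_prod_erase _ _ (Finset.mem_range.2 hi)] at h1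
    have h2 : 1 ≤ ∏ k ∈ (Finset.range (d + 1)).erase i, (1 - ρ n k) := by
      refine Finset.prod_induction _ (fun t : ℝ => 1 ≤ t) (fun a b => one_le_mul_of_one_le_of_one_le)
        le_rfl fun k hk => ?_
      have := hn k (Finset.mem_range.1 (Finset.mem_of_mem_erase hk))
      linarith
    have h3 := hn i hi
    nlinarith
  have hbound' : ∀ n, ∀ i < d, σ n i ∈ Set.Icc (1 - B) 0 := fun n i hi =>
    ⟨(hbound n (i + 1) (by omega)).1.trans ((hsep n).2.2.1 i hi),
      ((hsep n).2.1 i hi).trans ((hsep n).1 i (by omega))⟩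
  let F := Filter.hyperfilter ℕ
  have hF : (F : Filter ℕ) ≤ atTop := Nat.hyperfilter_le_atTop
  have hlim : ∀ u : ℕ → ℝ, (∀ n, u n ∈ Set.Icc (1 - B) 0) → ∃ a, Tendsto u F (𝓝 a) := by
    intro u hu
    obtain ⟨a, -, ha⟩ := isCompact_Icc.ultrafilter_le_nhds' (F.map u)
      (show u ⁻¹' Set.Icc (1 - B) 0 ∈ (F : Filter ℕ) from Filter.univ_mem' hu)
    exact ⟨a, ha⟩
  have hρ : ∀ i, ∃ a, i < d + 1 → Tendsto (fun n => ρ n i) F (𝓝 a) := fun i => by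
    by_cases hi : i < d + 1
    · obtain ⟨a, ha⟩ := hlim _ fun n => hbound n i hi
      exact ⟨a, fun _ => ha⟩
    · exact ⟨0, fun h => absurd h hi⟩
  have hσ : ∀ i, ∃ a, i < d → Tendsto (fun n => σ n i) F (𝓝 a) := fun i => by
    by_cases hi : i < d
    · obtain ⟨a, ha⟩ := hlim _ fun n => hbound' n i hi
      exact ⟨a, fun _ => ha⟩
    · exact ⟨0, fun h => absurd h hi⟩
  choose ρ' hρ' using hρ
  choose σ' hσ' using hσ
  refine ⟨ρ', σ', fun i hi => ?_, fun i hi => ?_, fun i hi => ?_, ?_, ?_⟩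
  · exact le_of_tendsto' (hρ' i hi) fun n => (hsep n).1 i hi
  · exact le_of_tendsto_of_tendsto' (hσ' i hi) (hρ' i (by omega)) fun n => (hsep n).2.1 i hi
  · exact le_of_tendsto_of_tendsto' (hρ' (i + 1) (by omega)) (hσ' i hi)
      fun n => (hsep n).2.2.1 i hi
  · refine Polynomial.funext fun x => ?_
    have h1 : Tendsto (fun n => (P n).eval 0 * ∏ i ∈ Finset.range (d + 1), (x - ρ n i)) F
        (𝓝 (p.eval 0 * ∏ i ∈ Finset.range (d + 1), (x - ρ' i))) :=
      ((hP 0).mono_left hF).mul (tendsto_finsetProd _ fun i hi =>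
        tendsto_const_nhds.sub (hρ' i (Finset.mem_range.1 hi)))
    simp only [← hPe] at h1
    rw [tendsto_nhds_unique ((hP x).mono_left hF) h1]
    simp [eval_prod, coeff_zero_eq_eval_zero]
  · refine Polynomial.funext fun x => ?_
    have h1 : Tendsto (fun n => (Q n).eval 0 * ∏ i ∈ Finset.range d, (x - σ n i)) F
        (𝓝 (q.eval 0 * ∏ i ∈ Finset.range d, (x - σ' i))) :=
      ((hQ 0).mono_left hF).mul (tendsto_finsetProd _ fun i hi =>
        tendsto_const_nhds.sub (hσ' i (Finset.mem_range.1 hi)))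
    simp only [← hQe] at h1
    rw [tendsto_nhds_unique ((hQ x).mono_left hF) h1]
    simp [eval_prod, coeff_zero_eq_eval_zero]

theorem sectionPoly_add_C_mul (hr : r ≠ 0) (g : ℝ[X]) (t : ℝ) (k : ℕ) :
    sectionPoly (h + C t * g) r d k = sectionPoly h r d k + C t * sectionPoly g r d k := by
  ext n
  rw [coeff_add, coeff_C_mul, sectionPoly, sectionPoly, sectionPoly, coeff_contract hr,
    coeff_contract hr, coeff_contract hr, ← coeff_C_mul, ← coeff_add]
  congr 1
  ring

theorem decompLeft_add_C_mul (hr : r ≠ 0) (g : ℝ[X]) (t : ℝ) :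
    decompLeft (h + C t * g) r d e = decompLeft h r d e + C t * decompLeft g r d e := by
  simp only [decompLeft, sectionPoly_add_C_mul hr, Finset.sum_add_distrib, Finset.mul_sum]

theorem decompRight_add_C_mul (hr : r ≠ 0) (g : ℝ[X]) (t : ℝ) :
    decompRight (h + C t * g) r d e = decompRight h r d e + C t * decompRight g r d e := by
  simp only [decompRight, sectionPoly_add_C_mul hr, divX_add, divX_C_mul, Finset.sum_add_distrib,
    Finset.mul_sum]

theorem tendsto_eval_add_C_mul (p g : ℝ[X]) (x : ℝ) :
    Tendsto (fun n : ℕ => (p + C (1 / ((n : ℝ) + 1)) * g).eval x) atTop (𝓝 (p.eval x)) := by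
  have h1 := (tendsto_one_div_add_atTop_nhds_zero_nat (𝕜 := ℝ)).mul_const (g.eval x)
  simpa using h1.const_add (p.eval x)

/-- Positive middle coefficients of degrees `1, …, r - 1` can be added to an admissible polynomial of
degree `r`. -/
theorem Admissible.add_middle (H : Admissible h r) (hs : h.natDegree = r) {t : ℝ} (ht : 0 < t) :
    Admissible (h + C t * ∑ k ∈ Finset.Ico 1 r, X ^ k) r ∧
      (h + C t * ∑ k ∈ Finset.Ico 1 r, X ^ k).natDegree = r ∧
      0 < (h + C t * ∑ k ∈ Finset.Ico 1 r, X ^ k).coeff 1 := by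
  have h2 := H.two_le
  have hc : ∀ n, (h + C t * ∑ k ∈ Finset.Ico 1 r, X ^ k).coeff n =
      h.coeff n + if n ∈ Finset.Ico 1 r then t else 0 := by
    intro n
    rw [coeff_add, coeff_C_mul, finsetSum_coeff]
    simp only [coeff_X_pow, Finset.sum_ite_eq, mul_ite, mul_one, mul_zero]
  have hdeg : (h + C t * ∑ k ∈ Finset.Ico 1 r, X ^ k).natDegree = r := by
    refine le_antisymm (natDegree_le_iff_coeff_eq_zero.2 fun n hn => ?_)
      (le_natDegree_of_ne_zero ?_)
    · rw [hc, coeff_eq_zero_of_natDegree_lt (by omega), if_neg (by rw [Finset.mem_Ico]; omega),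
        add_zero]
    · rw [hc, if_neg (by simp), add_zero]
      have := H.palindromic 0 (Nat.zero_le _)
      rw [Nat.sub_zero, hs] at this
      rw [this]
      exact H.coeff_zero_pos.ne'
  refine ⟨⟨h2, fun n => ?_, fun k hk => ?_, hdeg.le, ?_⟩, hdeg, ?_⟩
  · rw [hc]
    have := H.nonneg n
    split_ifs <;> linarith
  · rw [hdeg] at hk ⊢
    have := H.palindromic k (by omega)
    rw [hs] at this
    rw [hc, hc, this]
    simp only [Finset.mem_Ico]
    congr 1
    exact if_congr (by omega) rfl rfl
  · rw [hc, if_neg (by simp), add_zero]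
    exact H.coeff_zero_pos
  · rw [hc, if_pos (by rw [Finset.mem_Ico]; omega)]
    linarith [H.nonneg 1]

theorem Admissible.exists_separatedRoots (H : Admissible h r)
    (he : (e : ℤ) = (d + 1 : ℕ) + 1 - h.natDegree) (he0 : e ≠ 0) (her : e ≤ r) :
    ∃ ρ σ, SeparatedRoots d (decompLeft h r (d + 1) e) (decompRight h r (d + 1) e) ρ σ := by
  have h2 := H.two_le
  rcases H.natDegree_le.lt_or_eq with hs | hs
  · exact H.separatedRoots_of_generic he he0 her (Or.inl hs)
  -- If `deg h = r`, the middle coefficients may vanish; make them positive and pass to the limit.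
  · have ht : ∀ n : ℕ, (0 : ℝ) < 1 / ((n : ℝ) + 1) := fun n => by positivity
    have hex : ∀ n : ℕ, ∃ ρ σ, SeparatedRoots d
        (decompLeft (h + C (1 / ((n : ℝ) + 1)) * ∑ k ∈ Finset.Ico 1 r, X ^ k) r (d + 1) e)
        (decompRight (h + C (1 / ((n : ℝ) + 1)) * ∑ k ∈ Finset.Ico 1 r, X ^ k) r (d + 1) e)
        ρ σ := by
      intro n
      obtain ⟨H', h3, h4⟩ := H.add_middle hs (ht n)
      exact H'.separatedRoots_of_generic (by rw [h3, he, hs]) he0 her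
        (Or.inr ⟨by omega, h3, 1, one_pos, by omega, h4⟩)
    choose ρ σ hsep using hex
    refine exists_separatedRoots_of_tendsto (fun x => ?_) (fun x => ?_)
      (coeff_zero_decompLeft_pos H.ne_zero H.nonneg H.coeff_zero_pos he0)
      (fun n => ?_) hsep
    · simp only [decompLeft_add_C_mul H.ne_zero]
      exact tendsto_eval_add_C_mul _ _ x
    · simp only [decompRight_add_C_mul H.ne_zero]
      exact tendsto_eval_add_C_mul _ _ x
    · obtain ⟨H', -, -⟩ := H.add_middle hs (ht n)
      exact coeff_zero_decompLeft_pos H'.ne_zero H'.nonneg H'.coeff_zero_pos he0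

theorem SeparatedRoots.interlaces {P Q : ℝ[X]} {ρ σ : ℕ → ℝ} (hsep : SeparatedRoots d P Q ρ σ)
    (hP : P.coeff 0 ≠ 0) : Interlaces Q P := by
  obtain ⟨-, h1, h2, h3, h4⟩ := hsep
  by_cases hQ : Q.coeff 0 = 0
  · rw [hQ, C_0, zero_mul] at h4
    refine ⟨h4 ▸ Splits.zero, ?_, Or.inl h4⟩
    rw [h3]
    exact splits_C_mul_prod
  · rw [h3, h4]
    exact interlaces_C_mul_prod hP hQ h1 h2

/-- A polynomial symmetric with respect to degree `-1` vanishes. -/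
theorem IsSymmetricPoly.eq_zero_of_neg_one {q : ℝ[X]} (hq : IsSymmetricPoly (-1) q) : q = 0 := by
  have hX : IsSymmetricPoly ((1 : ℕ) : ℤ) (X * q) := by
    intro x hx
    rw [eval_mul, eval_mul, eval_X, eval_X, hq x hx, Nat.cast_one, zpow_one, zpow_neg_one]
  have h1 := eq_X_add_C_of_natDegree_le_one hX.natDegree_le
  have h2 : (X * q).coeff 0 = 0 := by simp
  have h3 := hX.coeff_sub (Nat.zero_le 1)
  rw [Nat.sub_zero, h2] at h3
  rw [h2, h3, C_0, zero_mul, add_zero] at h1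
  exact (mul_eq_zero.1 h1).resolve_left X_ne_zero

end

/-! ### The symmetric decomposition interlaces -/

theorem theorem2 (d s : ℕ) (h : ℝ[X]) (hdeg : h.natDegree = s) (hsd : s ≤ d)
    (hnonneg : NonnegCoeffs h) (hpal : IsSymmetricPoly (s : ℤ) h)
    (r : ℕ) (hr : max s (d + 1 - s) ≤ r) :
    ∃ p q : ℝ[X], IsSymmetricDecomposition d (veroneseU r (d + 1) h) p q ∧
      NonnegCoeffs p ∧ NonnegCoeffs q ∧ Interlaces q p := by
  subst hdeg
  have hsr : h.natDegree ≤ r := (le_max_left _ _).trans hr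
  have her : d + 1 - h.natDegree ≤ r := (le_max_right _ _).trans hr
  have hr0 : r ≠ 0 := by omega
  have hcoeff : ∀ k ≤ h.natDegree, h.coeff (h.natDegree - k) = h.coeff k :=
    fun k hk => hpal.coeff_sub hk
  obtain ⟨e, he⟩ : ∃ e, e = d + 1 - h.natDegree := ⟨_, rfl⟩
  have he' : (e : ℤ) = d + 1 - h.natDegree := by omega
  have he0 : e ≠ 0 := by omega
  have hp := isSymmetricPoly_decompLeft hr0 hcoeff he'
  have hq := isSymmetricPoly_decompRight hr0 hcoeff he' he0
  refine ⟨decompLeft h r d e, decompRight h r d e, ⟨hp, hq, ?_⟩,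
    nonnegCoeffs_decompLeft hr0 hnonneg, nonnegCoeffs_decompRight hr0 hnonneg, ?_⟩
  · rw [veroneseU_eq_sectionPoly (by omega), sectionPoly_zero_eq hr0 he0 (by omega)]
  by_cases h0 : h = 0
  · have h1 : decompLeft h r d e = 0 := by
      ext n
      simp [decompLeft, sectionPoly, h0, coeff_contract hr0]
    have h2 : decompRight h r d e = 0 := by
      ext n
      simp [decompRight, sectionPoly, h0, coeff_contract hr0]
    rw [h1, h2]
    exact ⟨Splits.zero, Splits.zero, Or.inl rfl⟩
  have hpos : 0 < h.coeff 0 := by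
    refine lt_of_le_of_ne (hnonneg 0) fun h1 => ?_
    have h2 := hcoeff 0 (Nat.zero_le _)
    rw [← h1, Nat.sub_zero] at h2
    exact h0 (leadingCoeff_eq_zero.1 h2)
  by_cases hd : d = 0
  · subst hd
    have h1 : decompRight h r 0 e = 0 := hq.eq_zero_of_neg_one
    rw [h1]
    exact ⟨Splits.zero, Splits.of_natDegree_le_one (hp.natDegree_le.trans zero_le_one),
      Or.inl rfl⟩
  by_cases hr1 : r = 1
  · have h1 : decompRight h r d e = 0 := by
      rw [decompRight, Finset.Ico_eq_empty (by omega), Finset.sum_empty]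
    rw [h1]
    exact ⟨Splits.zero, Splits.of_natDegree_le_one (hp.natDegree_le.trans (by omega)),
      Or.inl rfl⟩
  obtain ⟨n, rfl⟩ := Nat.exists_eq_succ_of_ne_zero hd
  have H : Admissible h r := ⟨by omega, hnonneg, hcoeff, hsr, hpos⟩
  obtain ⟨ρ, σ, hsep⟩ := H.exists_separatedRoots he' he0 (by omega)
  exact hsep.interlaces (coeff_zero_decompLeft_pos hr0 hnonneg hpos he0).ne'
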